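/- Let $A_1,\dots,A_m$ and $B_1,\dots,B_m$ be positive semidefinite complex $d\times d$ matrices with $\ker B_j\subseteq\ker A_j$ for all $j$, and put $A=\sum_j A_j$, $B=\sum_j B_j$. For positive semidefinite $X$, the powers $X^{s}$ ($s\in\mathbb R$, $s\ne0$) and $X^{it}$ ($t\in\mathbb R$, including $t=0$), the inverse $X^{-1}$ and $\log X$ are understood on $(\ker X)^\perp$ and extended by $0$ on $\ker X$; $P_{(\ker X)^\perp}$ is the orthogonal projection onto $(\ker X)^\perp$. For $p\in(0,2)$ and positive semidefinite $X,Y$ with $\ker Y\subseteq\ker X$ let $$J_p(I,X,Y)=\begin{cases}\frac{1}{p(1-p)}\big(\mathrm{Tr}\,X-\mathrm{Tr}\,X^pY^{1-p}\big), & p\ne1,\\ \mathrm{Tr}\,X\log X-\mathrm{Tr}\,X\log Y, & p=1.\end{cases}$$ Then the following are equivalent. (a) $J_p(I,A,B)=\sum_j J_p(I,A_j,B_j)$ for all $p\in(0,2)$. (b) $J_p(I,A,B)=\sum_j J_p(I,A_j,B_j)$ for some $p\in(0,2)$. (c) $A_j^{it}B_j^{-it}=A^{it}B^{-it}P_{(\ker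 B_j)^\perp}$ for all $j$ and all $t\in\mathbb R$. (d) There are positive semidefinite matrices $D_1,\dots,D_m$ with $\ker D_j=\ker B_j$ and $[A_j,D_j]=[B_j,D_j]=0$ for all $j$ such that, with $D=\sum_j D_j$, one has $[A,D]=[B,D]=0$ and $$A_j=AD^{-1}D_j,\qquad B_j=BD^{-1}D_j\qquad\text{for all } j.$$ -/

import Mathlib

open scoped ComplexOrder

/-- The kernel of a matrix, as a subspace of `ℂ^d` with its Euclidean inner product. -/
noncomputable def matKer {d : ℕ} (A : Matrix (Fin d) (Fin d) ℂ) :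
    Submodule ℂ (EuclideanSpace ℂ (Fin d)) :=
  LinearMap.ker (Matrix.toEuclideanLin A)

/-- `P_{(ker B)^⊥}`: the matrix of the orthogonal projection onto `(ker B)^⊥`. -/
noncomputable def supportProj {d : ℕ} (B : Matrix (Fin d) (Fin d) ℂ) :
    Matrix (Fin d) (Fin d) ℂ :=
  (Matrix.toEuclideanCLM (n := Fin d) (𝕜 := ℂ)).symm ((matKer B)ᗮ.starProjection)

/-- Real power `A ^ s` of a positive semidefinite matrix for a real exponent `s ≠ 0`, by the
spectral functional calculus. As `0 ^ s = 0` for `s ≠ 0` in Mathlib, for negative `s` this is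
the power of `A` restricted to `(ker A)^⊥`, extended by `0` on `ker A`. -/
noncomputable def matRpow {d : ℕ} (A : Matrix (Fin d) (Fin d) ℂ) (s : ℝ) :
    Matrix (Fin d) (Fin d) ℂ :=
  cfc (fun x : ℝ => x ^ s) A

/-- `log A`, by the spectral functional calculus; as `Real.log 0 = 0`, it is the logarithm of
`A` restricted to `(ker A)^⊥`, extended by `0` on `ker A`. -/
noncomputable def matLog {d : ℕ} (A : Matrix (Fin d) (Fin d) ℂ) :
    Matrix (Fin d) (Fin d) ℂ :=
  cfc Real.log A

/-- `D⁻¹` on `(ker D)^⊥`, extended by `0` on `ker D` (as `0⁻¹ = 0` in `ℝ`). -/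
noncomputable def matInv {d : ℕ} (D : Matrix (Fin d) (Fin d) ℂ) :
    Matrix (Fin d) (Fin d) ℂ :=
  cfc (fun x : ℝ => x⁻¹) D

/-- `A ^ (i t)` for a positive semidefinite `A` and real `t`: the spectral functional calculus
applied to `x ↦ x ^ (i t) = cos (t log x) + i sin (t log x)` for `x ≠ 0` and `0 ↦ 0`.
So `A ^ (i t)` is unitary on `(ker A)^⊥` and vanishes on `ker A`. -/
noncomputable def matPowI {d : ℕ} (A : Matrix (Fin d) (Fin d) ℂ) (t : ℝ) :
    Matrix (Fin d) (Fin d) ℂ :=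
  cfc (fun x : ℝ => if x = 0 then 0 else Real.cos (t * Real.log x)) A
    + Complex.I • cfc (fun x : ℝ => if x = 0 then 0 else Real.sin (t * Real.log x)) A

/-- The functional `J_p(K, A, B)`:
`(1 / (p (1 - p))) (Tr K* A K - Tr K* A^p K B^(1-p))` for `p ≠ 1`, and
`Tr K K* A log A - Tr K* A K log B` for `p = 1`. All these traces are real for positive
semidefinite `A`, `B`. With the conventions above for `B^(1-p)` and `log`, the formula also
gives the extension by continuity of `J_p(1, A, B)`, `0 < p < 2`, to positive semidefinite
`A`, `B` with `ker B ⊆ ker A`. -/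
noncomputable def Jp {d : ℕ} (p : ℝ) (K A B : Matrix (Fin d) (Fin d) ℂ) : ℝ :=
  if p = 1 then
    ((K * K.conjTranspose * A * matLog A).trace
      - (K.conjTranspose * A * K * matLog B).trace).re
  else
    1 / (p * (1 - p)) *
      ((K.conjTranspose * A * K).trace
        - (K.conjTranspose * matRpow A p * K * matRpow B (1 - p)).trace).re

/-!
For positive semidefinite `A`, `B` with `ker B ⊆ ker A`, left multiplication by `A` and right
multiplication by `B⁻¹` commute, and the operator `Δ : X ↦ A X B⁻¹` has a functional calculus. Write
`f(Δ)(I) = ∑ f (x / y) P_A(x) P_B(y)` in terms of the spectral projections (`ratioCalc`; only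
functions with `f 0 = 0` are used). All four conditions are equivalent to

  `f(Δ_j)(I) = f(Δ)(I) P_j` for all `j` and all `f` with `f 0 = 0`,   (∗)

where `Δ_j` belongs to the pair `A_j`, `B_j` and `P_j` is the support projection of `B_j`
(`RatioCompatible`). As only finitely many ratios occur, it is enough to have (∗) for a family of
functions that spans all functions on every finite set of positive reals. Both the functions
`z / (z + t)`, `t > 0`, and the characters `z ^ (i t)` are such families (`spansOnFinite_resolvent`,
`spansOnFinite_imagPow`). For the characters, (∗) is the condition
`A_j^{it} B_j^{-it} = A^{it} B^{-it} P_j`.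

*The trace functionals.* `J_p(I, A, B) = Re Tr f_p(Δ)(I) B` for a scalar function `f_p`
(`Jp_eq_trace`), so (∗) gives the additivity of `J_p` for each `p`. Conversely, for `0 < p < 2`,
`f_p(z)` is a positive multiple of `∫ t ^ (p - 1) (z / (1 + t) - z / (z + t)) dt` over `t > 0`
(`exists_entropyFun_eq_integral`). For `g_t z = z / (z + t)`, the number `t Tr g_t(Δ)(I) B` is the
minimum over `X` of `Tr (1 - X)* A (1 - X) + t Tr X B X*`, which is additive in the pair `A`, `B`;
the minimizer solves `A X + t X B = A` and is unique on the support of `B` (`parallelForm_eq`).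
Hence `Tr g_t(Δ)(I) B` is superadditive. If `J_p` is additive for one `p`, then so is
`Tr g_t(Δ)(I) B` for every `t`, and the minimizer for the sums is a minimizer for each of the pairs,
which is (∗) for `g_t`.

*From the factorization.* If `A_j = A D⁻¹ D_j` and `B_j = B D⁻¹ D_j`, then the solution of the
Sylvester equation for `A D⁻¹`, `B D⁻¹` commutes with every `D_j`, and therefore solves the
equation for every pair `A_j`, `B_j` and for the sums (`ratioCompatible_of_factorization`).

*To the factorization.* Let `N` be the *-algebra generated by all `f(Δ)(I)`. The projections `P_j`
commute with `N`. The commutator with `log B` maps `N` to itself, and on `N` the commutator with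
`log B_j` is the one with `log B`, times `P_j` (`RatioCompatible.matLog_commutator_eq`). The
component `h ∈ N` of `log B` with respect to the trace form implements this derivation
(`exists_hermitian_implementer`). So `M_j = log B_j - h P_j` commutes with `N`, and
`D_j = P_j exp M_j` satisfies `B_j = (exp h) D_j` and `A_j = Δ(I) (exp h) D_j`, where the factors
in front of `D_j` do not depend on `j` and commute with `D_j`
(`exists_factorization_of_ratioCompatible`).
-/

namespace RatioCalculus

open Matrix

variable {d : ℕ} {A B : Matrix (Fin d) (Fin d) ℂ}

/-! ### Spectral projections and the functional calculus with complex values -/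

/-- The spectral projection of a Hermitian matrix `A` at the real number `x`; it is `0` if `x` is
not an eigenvalue. -/
noncomputable def specProj (A : Matrix (Fin d) (Fin d) ℂ) (x : ℝ) : Matrix (Fin d) (Fin d) ℂ :=
  cfc (fun y : ℝ => if y = x then (1 : ℝ) else 0) A

/-- The set of real eigenvalues of `A`, as a finset. -/
noncomputable def specSet (A : Matrix (Fin d) (Fin d) ℂ) : Finset ℝ :=
  A.finite_real_spectrum.toFinset

/-- The functional calculus of a Hermitian matrix for complex-valued functions on its spectrum. -/
noncomputable def funCalc (f : ℝ → ℂ) (A : Matrix (Fin d) (Fin d) ℂ) :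
    Matrix (Fin d) (Fin d) ℂ :=
  ∑ x ∈ specSet A, f x • specProj A x

theorem mem_specSet {x : ℝ} : x ∈ specSet A ↔ x ∈ spectrum ℝ A := by
  simp [specSet]

theorem continuousOn_spectrum (f : ℝ → ℝ) (A : Matrix (Fin d) (Fin d) ℂ) :
    ContinuousOn f (spectrum ℝ A) :=
  A.finite_real_spectrum.continuousOn f

theorem specSet_nonneg (hA : A.PosSemidef) {x : ℝ} (hx : x ∈ specSet A) : 0 ≤ x := by
  rw [mem_specSet, hA.1.spectrum_real_eq_range_eigenvalues] at hx
  obtain ⟨i, rfl⟩ := hx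
  exact hA.eigenvalues_nonneg i

theorem conjTranspose_specProj (A : Matrix (Fin d) (Fin d) ℂ) (x : ℝ) :
    (specProj A x)ᴴ = specProj A x :=
  (cfc_predicate (R := ℝ) (p := IsSelfAdjoint)
    (fun y : ℝ => if y = x then (1 : ℝ) else 0) A).star_eq

theorem specProj_mul_specProj (A : Matrix (Fin d) (Fin d) ℂ) (x y : ℝ) :
    specProj A x * specProj A y = if x = y then specProj A x else 0 := by
  unfold specProj
  rw [← cfc_mul _ _ A (continuousOn_spectrum _ A) (continuousOn_spectrum _ A)]
  split_ifs with h
  · subst h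
    congr 1
    ext z
    split_ifs <;> simp
  · rw [← cfc_zero ℝ A]
    congr 1
    ext z
    by_cases h1 : z = x
    · subst h1; simp [h]
    · simp [h1]

theorem cfc_eq_funCalc (f : ℝ → ℝ) (A : Matrix (Fin d) (Fin d) ℂ) :
    cfc f A = funCalc (fun x => (f x : ℂ)) A := by
  have h : cfc f A =
      cfc (∑ x ∈ specSet A, fun y : ℝ => f x • (if y = x then (1 : ℝ) else 0)) A := by
    apply cfc_congr
    intro y hy
    rw [← mem_specSet] at hy
    simp [Finset.sum_apply, hy]
  rw [h, cfc_sum _ A _ (fun i _ => continuousOn_spectrum _ A)]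
  refine Finset.sum_congr rfl fun x _ => ?_
  rw [cfc_smul _ _ A (continuousOn_spectrum _ A)]
  exact (Complex.coe_smul (f x) (specProj A x)).symm

theorem funCalc_congr {f g : ℝ → ℂ} (h : ∀ x ∈ specSet A, f x = g x) :
    funCalc f A = funCalc g A :=
  Finset.sum_congr rfl fun x hx => by rw [h x hx]

theorem funCalc_one (hA : A.IsHermitian) : funCalc (fun _ => 1) A = 1 := by
  have h := cfc_eq_funCalc (fun _ => 1) A
  have h1 : cfc (fun _ : ℝ => (1 : ℝ)) A = 1 := cfc_const_one ℝ A hA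
  rw [h1] at h
  simpa using h.symm

theorem funCalc_id (hA : A.IsHermitian) : funCalc (fun x => (x : ℂ)) A = A := by
  rw [← cfc_eq_funCalc (fun x => x) A]
  exact cfc_id' ℝ A hA

theorem specProj_eq_funCalc (A : Matrix (Fin d) (Fin d) ℂ) (x : ℝ) :
    specProj A x = funCalc (fun y => if y = x then 1 else 0) A := by
  unfold specProj
  rw [cfc_eq_funCalc]
  simp only [apply_ite Complex.ofReal, Complex.ofReal_one, Complex.ofReal_zero]

theorem funCalc_mul (f g : ℝ → ℂ) (A : Matrix (Fin d) (Fin d) ℂ) :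
    funCalc f A * funCalc g A = funCalc (fun x => f x * g x) A := by
  simp only [funCalc, Finset.sum_mul_sum, smul_mul_smul_comm, specProj_mul_specProj]
  refine Finset.sum_congr rfl fun x hx => ?_
  simp [hx]

theorem mul_funCalc (hA : A.IsHermitian) (f : ℝ → ℂ) :
    A * funCalc f A = funCalc (fun x => x * f x) A := by
  rw [← funCalc_mul, funCalc_id hA]

theorem funCalc_mul_self (hA : A.IsHermitian) (f : ℝ → ℂ) :
    funCalc f A * A = funCalc (fun x => f x * x) A := by
  rw [← funCalc_mul, funCalc_id hA]

theorem conjTranspose_funCalc (f : ℝ → ℂ) (A : Matrix (Fin d) (Fin d) ℂ) :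
    (funCalc f A)ᴴ = funCalc (fun x => star (f x)) A := by
  simp [funCalc, conjTranspose_sum, conjTranspose_smul, conjTranspose_specProj]

theorem funCalc_sub (f g : ℝ → ℂ) (A : Matrix (Fin d) (Fin d) ℂ) :
    funCalc f A - funCalc g A = funCalc (fun x => f x - g x) A := by
  simp [funCalc, sub_smul]

theorem Commute.specProj {X : Matrix (Fin d) (Fin d) ℂ} (h : Commute A X) (x : ℝ) :
    Commute (specProj A x) X :=
  Commute.cfc_real h _

theorem Commute.funCalc {X : Matrix (Fin d) (Fin d) ℂ} (h : Commute A X) (f : ℝ → ℂ) :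
    Commute (funCalc f A) X :=
  Commute.sum_left _ _ _ fun x _ => (Commute.specProj h x).smul_left (f x)

theorem matPowI_eq_funCalc (A : Matrix (Fin d) (Fin d) ℂ) (t : ℝ) :
    matPowI A t =
      funCalc (fun x => if x = 0 then 0 else Complex.exp (t * Real.log x * Complex.I)) A := by
  unfold matPowI
  rw [cfc_eq_funCalc, cfc_eq_funCalc]
  simp only [funCalc, Finset.smul_sum, ← Finset.sum_add_distrib, smul_smul, ← add_smul]
  refine Finset.sum_congr rfl fun x _ => ?_
  congr 1
  split_ifs with h
  · simp
  · rw [Complex.exp_mul_I]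
    push_cast
    ring

/-! ### The support projection -/

theorem mulVec_eq_zero_iff_mem_matKer {v : EuclideanSpace ℂ (Fin d)} :
    v ∈ matKer A ↔ A *ᵥ v.ofLp = 0 := by
  rw [matKer, LinearMap.mem_ker, Matrix.toLpLin_apply]
  simp

theorem matKer_le_iff :
    matKer B ≤ matKer A ↔ ∀ v : Fin d → ℂ, B *ᵥ v = 0 → A *ᵥ v = 0 := by
  constructor
  · intro h v hv
    have := h (x := WithLp.toLp 2 v) (mulVec_eq_zero_iff_mem_matKer.2 hv)
    exact mulVec_eq_zero_iff_mem_matKer.1 this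
  · intro h v hv
    exact mulVec_eq_zero_iff_mem_matKer.2 (h _ (mulVec_eq_zero_iff_mem_matKer.1 hv))

/-- An inclusion of kernels in terms of annihilated matrices instead of vectors. -/
theorem mul_eq_zero_of_matKer_le (h : matKer B ≤ matKer A) {X : Matrix (Fin d) (Fin d) ℂ}
    (hX : B * X = 0) : A * X = 0 := by
  rw [matKer_le_iff] at h
  ext i j
  have h1 := h (X.col j) (by
    ext k
    have := congrFun (congrFun hX k) j
    simpa [Matrix.mul_apply, mulVec, dotProduct] using this)
  have := congrFun h1 i
  simpa [Matrix.mul_apply, mulVec, dotProduct] using this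

/-- A Hermitian `P` with `ker B ⊆ ker P` and `B P = B` is the orthogonal projection onto `(ker B)ᗮ`:
its values are orthogonal to `ker B`, and `v - P v` lies in `ker B`. -/
theorem supportProj_eq_of {P : Matrix (Fin d) (Fin d) ℂ} (hP : Pᴴ = P)
    (h1 : ∀ v : Fin d → ℂ, B *ᵥ v = 0 → P *ᵥ v = 0) (h2 : B * P = B) : supportProj B = P := by
  unfold supportProj
  rw [StarAlgEquiv.symm_apply_eq]
  ext1 v
  refine Submodule.eq_starProjection_of_mem_orthogonal ?_ ?_
  · rw [Submodule.mem_orthogonal']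
    intro w hw
    have hw' := h1 _ (mulVec_eq_zero_iff_mem_matKer.1 hw)
    rw [EuclideanSpace.inner_eq_star_dotProduct, ofLp_toEuclideanCLM, star_mulVec, hP,
      dotProduct_comm, ← dotProduct_mulVec, hw', dotProduct_zero]
  · apply Submodule.le_orthogonal_orthogonal
    rw [mulVec_eq_zero_iff_mem_matKer, WithLp.ofLp_sub, ofLp_toEuclideanCLM, mulVec_sub,
      mulVec_mulVec, h2, sub_self]

theorem supportProj_eq_funCalc (hB : B.IsHermitian) :
    supportProj B = funCalc (fun x => if x = 0 then 0 else 1) B := by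
  apply supportProj_eq_of
  · rw [conjTranspose_funCalc]
    congr 1
    ext x
    split_ifs <;> simp
  · intro v hv
    have h : funCalc (fun x => if x = 0 then 0 else 1) B = funCalc (fun x => (x : ℂ)⁻¹) B * B := by
      rw [funCalc_mul_self hB]
      congr 1
      ext x
      split_ifs with hx
      · simp [hx]
      · rw [inv_mul_cancel₀]
        exact_mod_cast hx
    rw [h, ← mulVec_mulVec, hv, mulVec_zero]
  · rw [mul_funCalc hB]
    nth_rw 2 [← funCalc_id hB]
    congr 1
    ext x
    split_ifs with hx <;> simp [hx]

/-! ### The joint functional calculus of two matrices -/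

/-- The joint calculus of left multiplication by `A` and right multiplication by `B`, applied to
the identity: `∑ φ x y • P_A(x) P_B(y)`, for `φ` a function of two real variables. -/
noncomputable def jointCalc (φ : ℝ → ℝ → ℂ) (A B : Matrix (Fin d) (Fin d) ℂ) :
    Matrix (Fin d) (Fin d) ℂ :=
  ∑ x ∈ specSet A, ∑ y ∈ specSet B, φ x y • (specProj A x * specProj B y)

theorem funCalc_mul_funCalc (f g : ℝ → ℂ) (A B : Matrix (Fin d) (Fin d) ℂ) :
    funCalc f A * funCalc g B = jointCalc (fun x y => f x * g y) A B := by
  simp only [funCalc, jointCalc, Finset.sum_mul_sum, smul_mul_smul_comm]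

theorem funCalc_mul_specProj (f : ℝ → ℂ) {x : ℝ} (hx : x ∈ specSet A) :
    funCalc f A * specProj A x = f x • specProj A x := by
  simp [funCalc, Finset.sum_mul, specProj_mul_specProj, hx]

theorem specProj_mul_funCalc (f : ℝ → ℂ) {x : ℝ} (hx : x ∈ specSet A) :
    specProj A x * funCalc f A = f x • specProj A x := by
  simp [funCalc, Finset.mul_sum, specProj_mul_specProj, hx]

theorem funCalc_mul_jointCalc (f : ℝ → ℂ) (φ : ℝ → ℝ → ℂ) (A B : Matrix (Fin d) (Fin d) ℂ) :
    funCalc f A * jointCalc φ A B = jointCalc (fun x y => f x * φ x y) A B := by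
  simp only [jointCalc, Finset.mul_sum]
  refine Finset.sum_congr rfl fun x hx => Finset.sum_congr rfl fun y _ => ?_
  rw [mul_smul_comm, ← mul_assoc, funCalc_mul_specProj f hx, smul_mul_assoc, smul_smul, mul_comm]

theorem jointCalc_mul_funCalc (f : ℝ → ℂ) (φ : ℝ → ℝ → ℂ) (A B : Matrix (Fin d) (Fin d) ℂ) :
    jointCalc φ A B * funCalc f B = jointCalc (fun x y => φ x y * f y) A B := by
  simp only [jointCalc, Finset.sum_mul]
  refine Finset.sum_congr rfl fun x _ => Finset.sum_congr rfl fun y hy => ?_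
  rw [smul_mul_assoc, mul_assoc, specProj_mul_funCalc f hy, mul_smul_comm, smul_smul]

theorem jointCalc_add (φ ψ : ℝ → ℝ → ℂ) (A B : Matrix (Fin d) (Fin d) ℂ) :
    jointCalc φ A B + jointCalc ψ A B = jointCalc (fun x y => φ x y + ψ x y) A B := by
  simp [jointCalc, add_smul, Finset.sum_add_distrib]

theorem jointCalc_sub (φ ψ : ℝ → ℝ → ℂ) (A B : Matrix (Fin d) (Fin d) ℂ) :
    jointCalc φ A B - jointCalc ψ A B = jointCalc (fun x y => φ x y - ψ x y) A B := by
  simp [jointCalc, sub_smul, Finset.sum_sub_distrib]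

theorem jointCalc_smul (c : ℂ) (φ : ℝ → ℝ → ℂ) (A B : Matrix (Fin d) (Fin d) ℂ) :
    c • jointCalc φ A B = jointCalc (fun x y => c * φ x y) A B := by
  simp [jointCalc, Finset.smul_sum, smul_smul]

theorem funCalc_left_eq_jointCalc (hB : B.IsHermitian) (f : ℝ → ℂ) :
    funCalc f A = jointCalc (fun x _ => f x) A B := by
  have h := funCalc_mul_funCalc f (fun _ => 1) A B
  rw [funCalc_one hB] at h
  simpa using h

/-- If `ker B ⊆ ker A`, then the spectral projections `P_A(x)`, `x ≠ 0`, and `P_B(0)` are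
orthogonal. -/
theorem specProj_mul_specProj_zero (hA : A.IsHermitian) (hB : B.IsHermitian)
    (h : matKer B ≤ matKer A) {x : ℝ} (hx : x ≠ 0) : specProj A x * specProj B 0 = 0 := by
  have h1 : B * specProj B 0 = 0 := by
    rw [specProj_eq_funCalc, mul_funCalc hB, ← sub_self (funCalc (fun _ => 0) B), funCalc_sub]
    congr 1
    ext x
    split_ifs with hx <;> simp [hx]
  have h2 : specProj A x = funCalc (fun y => if y = x then (x : ℂ)⁻¹ else 0) A * A := by
    rw [specProj_eq_funCalc, funCalc_mul_self hA]
    congr 1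
    ext y
    split_ifs with hy
    · subst hy
      rw [inv_mul_cancel₀]
      exact_mod_cast hx
    · simp
  rw [h2, mul_assoc, mul_eq_zero_of_matKer_le h h1, mul_zero]

/-- For positive semidefinite `A`, `B` with `ker B ⊆ ker A`, the joint calculus sees only the
values of the function on `[0, ∞) × (0, ∞)` and at the origin. -/
theorem jointCalc_congr (hA : A.PosSemidef) (hB : B.PosSemidef) (h : matKer B ≤ matKer A)
    {φ ψ : ℝ → ℝ → ℂ} (h0 : φ 0 0 = ψ 0 0) (h1 : ∀ x y, 0 ≤ x → 0 < y → φ x y = ψ x y) :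
    jointCalc φ A B = jointCalc ψ A B := by
  refine Finset.sum_congr rfl fun x hx => Finset.sum_congr rfl fun y hy => ?_
  rcases (specSet_nonneg hB hy).eq_or_lt with hy0 | hy0
  · subst hy0
    by_cases hx0 : x = 0
    · rw [hx0, h0]
    · rw [specProj_mul_specProj_zero hA.1 hB.1 h hx0, smul_zero, smul_zero]
  · rw [h1 x y (specSet_nonneg hA hx) hy0]

theorem Commute.jointCalc {X : Matrix (Fin d) (Fin d) ℂ} (hA : Commute A X) (hB : Commute B X)
    (φ : ℝ → ℝ → ℂ) : Commute (jointCalc φ A B) X :=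
  Commute.sum_left _ _ _ fun x _ => Commute.sum_left _ _ _ fun y _ =>
    ((Commute.specProj hA x).mul_left (Commute.specProj hB y)).smul_left (φ x y)

/-! ### Functions of the ratio -/

/-- A pair of positive semidefinite matrices `A`, `B` with `ker B ⊆ ker A`. -/
structure SupportedPair (A B : Matrix (Fin d) (Fin d) ℂ) : Prop where
  left : A.PosSemidef
  right : B.PosSemidef
  ker_le : matKer B ≤ matKer A

/-- The function `f` of the relative modular operator `X ↦ A X B⁻¹`, applied to the identity:
`∑ f (x / y) • P_A(x) P_B(y)`. It is used for `f 0 = 0`; as `x / 0 = 0`, the kernel of `B` then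
does not contribute. -/
noncomputable def ratioCalc (f : ℝ → ℂ) (A B : Matrix (Fin d) (Fin d) ℂ) :
    Matrix (Fin d) (Fin d) ℂ :=
  jointCalc (fun x y => f (x / y)) A B

/-- The component of the identity in the eigenspace of `X ↦ A X B⁻¹` at `r`. -/
noncomputable def ratioPart (A B : Matrix (Fin d) (Fin d) ℂ) (r : ℝ) : Matrix (Fin d) (Fin d) ℂ :=
  ratioCalc (fun z => if z = r then 1 else 0) A B

/-- The nonzero eigenvalues of `X ↦ A X B⁻¹`. -/
noncomputable def ratioSet (A B : Matrix (Fin d) (Fin d) ℂ) : Finset ℝ :=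
  ((specSet A ×ˢ specSet B).image fun q => q.1 / q.2).erase 0

theorem ratioSet_pos (h : SupportedPair A B) {r : ℝ} (hr : r ∈ ratioSet A B) : 0 < r := by
  simp only [ratioSet, Finset.mem_erase, Finset.mem_image, Finset.mem_product] at hr
  obtain ⟨h0, ⟨x, y⟩, ⟨hx, hy⟩, rfl⟩ := hr
  exact lt_of_le_of_ne (div_nonneg (specSet_nonneg h.left hx) (specSet_nonneg h.right hy)) h0.symm

theorem ratioCalc_eq_sum {f : ℝ → ℂ} (hf : f 0 = 0) {F : Finset ℝ} (hF : ratioSet A B ⊆ F)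
    (hF0 : ∀ r ∈ F, 0 < r) : ratioCalc f A B = ∑ r ∈ F, f r • ratioPart A B r := by
  simp only [ratioPart, ratioCalc, jointCalc, Finset.smul_sum, smul_smul]
  symm
  rw [Finset.sum_comm]
  refine Finset.sum_congr rfl fun x hx => ?_
  rw [Finset.sum_comm]
  refine Finset.sum_congr rfl fun y hy => ?_
  rw [← Finset.sum_smul]
  congr 1
  simp only [mul_ite, mul_one, mul_zero]
  by_cases h0 : x / y = 0
  · rw [h0, hf, Finset.sum_eq_zero]
    intro r hr
    rw [if_neg (hF0 r hr).ne]
  · have : x / y ∈ F := by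
      apply hF
      simp only [ratioSet, Finset.mem_erase, Finset.mem_image, Finset.mem_product]
      exact ⟨h0, ⟨x, y⟩, ⟨hx, hy⟩, rfl⟩
    simp [this]

/-- The junk value `x / 0 = 0` is harmless: for `x ≠ 0` the corresponding term vanishes because
`ker B ⊆ ker A`. -/
theorem ratioCalc_eq_jointCalc (h : SupportedPair A B) {f : ℝ → ℂ} (hf : f 0 = 0)
    {φ : ℝ → ℝ → ℂ} (h0 : φ 0 0 = 0) (h1 : ∀ x y, 0 ≤ x → 0 < y → f (x / y) = φ x y) :
    ratioCalc f A B = jointCalc φ A B :=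
  jointCalc_congr h.left h.right h.ker_le (by simp [hf, h0]) h1

theorem ratioCalc_mul_supportProj (h : SupportedPair A B) {f : ℝ → ℂ} (hf : f 0 = 0) :
    ratioCalc f A B * supportProj B = ratioCalc f A B := by
  rw [supportProj_eq_funCalc h.right.1, ratioCalc, jointCalc_mul_funCalc]
  refine jointCalc_congr h.left h.right h.ker_le (by simp [hf]) fun x y _ hy => ?_
  simp [hy.ne']

theorem supportProj_left_mul_ratioCalc (h : SupportedPair A B) {f : ℝ → ℂ} (hf : f 0 = 0) :
    supportProj A * ratioCalc f A B = ratioCalc f A B := by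
  rw [supportProj_eq_funCalc h.left.1, ratioCalc, funCalc_mul_jointCalc]
  refine jointCalc_congr h.left h.right h.ker_le (by simp [hf]) fun x y _ hy => ?_
  by_cases hx : x = 0 <;> simp [hx, hf]

theorem conjTranspose_supportProj (hB : B.IsHermitian) : (supportProj B)ᴴ = supportProj B := by
  rw [supportProj_eq_funCalc hB, conjTranspose_funCalc]
  congr 1
  ext x
  split_ifs <;> simp

theorem supportProj_mul_self (hB : B.IsHermitian) :
    supportProj B * supportProj B = supportProj B := by
  rw [supportProj_eq_funCalc hB, funCalc_mul]
  congr 1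
  ext x
  split_ifs <;> simp

theorem mul_supportProj (hB : B.IsHermitian) : B * supportProj B = B := by
  rw [supportProj_eq_funCalc hB, mul_funCalc hB]
  nth_rw 2 [← funCalc_id hB]
  congr 1
  ext x
  split_ifs with hx <;> simp [hx]

theorem supportProj_mul (hB : B.IsHermitian) : supportProj B * B = B := by
  have h := congrArg conjTranspose (mul_supportProj hB)
  rwa [conjTranspose_mul, conjTranspose_supportProj hB, hB.eq] at h

theorem mul_one_sub_supportProj (hB : B.IsHermitian) : B * (1 - supportProj B) = 0 := by
  rw [mul_sub, mul_one, mul_supportProj hB, sub_self]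

theorem mul_supportProj_of_matKer_le (hB : B.IsHermitian) (h : matKer B ≤ matKer A) :
    A * supportProj B = A := by
  have h1 := mul_eq_zero_of_matKer_le h (mul_one_sub_supportProj hB)
  rw [mul_sub, mul_one, sub_eq_zero] at h1
  exact h1.symm

theorem supportProj_mul_of_matKer_le (hA : A.IsHermitian) (hB : B.IsHermitian)
    (h : matKer B ≤ matKer A) : supportProj B * A = A := by
  have h := congrArg conjTranspose (mul_supportProj_of_matKer_le hB h)
  rwa [conjTranspose_mul, conjTranspose_supportProj hB, hA.eq] at h

theorem mul_supportProj_eq_zero (hB : B.IsHermitian) {X : Matrix (Fin d) (Fin d) ℂ}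
    (h : X * B = 0) : X * supportProj B = 0 := by
  have h1 : supportProj B = B * funCalc (fun x => (x : ℂ)⁻¹) B := by
    rw [supportProj_eq_funCalc hB, mul_funCalc hB]
    congr 1
    ext x
    split_ifs with hx
    · simp [hx]
    · rw [mul_inv_cancel₀]
      exact_mod_cast hx
  rw [h1, ← mul_assoc, h, zero_mul]

theorem supportProj_mul_funCalc (hA : A.IsHermitian) {f : ℝ → ℂ} (hf : f 0 = 0) :
    supportProj A * funCalc f A = funCalc f A := by
  rw [supportProj_eq_funCalc hA, funCalc_mul]
  congr 1
  ext x
  split_ifs with hx <;> simp [hx, hf]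

theorem matKer_supportProj (hB : B.IsHermitian) : matKer (supportProj B) = matKer B := by
  apply le_antisymm
  · rw [matKer_le_iff]
    intro v hv
    rw [← mul_supportProj hB, ← mulVec_mulVec, hv, mulVec_zero]
  · rw [matKer_le_iff]
    intro v hv
    have h1 : supportProj B = funCalc (fun x => (x : ℂ)⁻¹) B * B := by
      rw [supportProj_eq_funCalc hB, funCalc_mul_self hB]
      congr 1
      ext x
      split_ifs with hx
      · simp [hx]
      · rw [inv_mul_cancel₀]
        exact_mod_cast hx
    rw [h1, ← mulVec_mulVec, hv, mulVec_zero]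

/-- The range of `f(Δ)(I)` lies in that of `A`, hence in that of `B`. -/
theorem supportProj_left_mul_ratioCalc_right (h : SupportedPair A B) {f : ℝ → ℂ} (hf : f 0 = 0) :
    supportProj B * ratioCalc f A B = ratioCalc f A B := by
  have hA : supportProj B * supportProj A = supportProj A :=
    supportProj_mul_of_matKer_le (conjTranspose_supportProj h.left.1) h.right.1
      (by rw [matKer_supportProj h.left.1]; exact h.ker_le)
  rw [← supportProj_left_mul_ratioCalc h hf, ← mul_assoc, hA]

/-! ### Families of functions that separate positive reals -/

/-- A family of functions on the positive reals whose restrictions to any finite set span all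
functions on that set, stated dually. -/
def SpansOnFinite {ι : Type*} (g : ι → ℝ → ℂ) : Prop :=
  ∀ F : Finset ℝ, (∀ r ∈ F, 0 < r) → ∀ c : ℝ → ℂ, (∀ i, ∑ r ∈ F, g i r * c r = 0) →
    ∀ r ∈ F, c r = 0

theorem SpansOnFinite.eq_zero {ι : Type*} {g : ι → ℝ → ℂ} (hg : SpansOnFinite g) {F : Finset ℝ}
    (hF : ∀ r ∈ F, 0 < r) {C : ℝ → Matrix (Fin d) (Fin d) ℂ}
    (h : ∀ i, ∑ r ∈ F, g i r • C r = 0) {r : ℝ} (hr : r ∈ F) : C r = 0 := by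
  ext k l
  refine hg F hF (fun r => C r k l) (fun i => ?_) r hr
  have := congrFun (congrFun (h i) k) l
  simpa [Matrix.sum_apply] using this

/-- Partial fractions with distinct poles are linearly independent. -/
theorem spansOnFinite_resolvent :
    SpansOnFinite (fun (t : Set.Ioi (0 : ℝ)) (r : ℝ) => (r : ℂ) / (r + (t : ℝ))) := by
  intro F hF c h r hr
  -- Clearing denominators gives a polynomial that vanishes for all `t > 0`, hence everywhere; its
  -- value at `-r` is a nonzero multiple of `c r`.
  let p : Polynomial ℂ := ∑ s ∈ F, Polynomial.C (c s * s) *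
    ∏ u ∈ F.erase s, (Polynomial.X + Polynomial.C (u : ℂ))
  have hp : p = 0 := by
    apply Polynomial.eq_zero_of_infinite_isRoot
    have hinf : (((↑) : ℝ → ℂ) '' Set.Ioi 0).Infinite :=
      (Set.Ioi_infinite 0).image Complex.ofReal_injective.injOn
    refine hinf.mono ?_
    rintro _ ⟨t, ht, rfl⟩
    have h1 : Polynomial.eval (t : ℂ) p =
        (∏ u ∈ F, ((t : ℂ) + u)) * ∑ s ∈ F, (s : ℂ) / (s + t) * c s := by
      rw [Finset.mul_sum, Polynomial.eval_finsetSum]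
      refine Finset.sum_congr rfl fun s hs => ?_
      have hne : (t : ℂ) + s ≠ 0 := by
        have : (0 : ℝ) < t + s := add_pos ht (hF s hs)
        exact_mod_cast this.ne'
      rw [← Finset.mul_prod_erase F _ hs, add_comm (s : ℂ)]
      simp only [Polynomial.eval_mul, Polynomial.eval_C, Polynomial.eval_prod,
        Polynomial.eval_add, Polynomial.eval_X]
      field_simp
    have h2 := h ⟨t, ht⟩
    change Polynomial.eval (t : ℂ) p = 0
    rw [h1]
    simp only at h2
    rw [h2, mul_zero]
  have h3 : Polynomial.eval (-(r : ℂ)) p = 0 := by rw [hp, Polynomial.eval_zero]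
  rw [Polynomial.eval_finsetSum, Finset.sum_eq_single_of_mem r hr] at h3
  · simp only [Polynomial.eval_mul, Polynomial.eval_C, Polynomial.eval_prod,
      Polynomial.eval_add, Polynomial.eval_X, mul_eq_zero, Finset.prod_eq_zero_iff] at h3
    rcases h3 with (h3 | h3) | ⟨u, hu, h3⟩
    · exact h3
    · exact absurd (by exact_mod_cast h3) (hF r hr).ne'
    · rw [neg_add_eq_zero] at h3
      exact absurd (by exact_mod_cast h3.symm) (Finset.ne_of_mem_erase hu)
  · intro s hs hsr
    simp only [Polynomial.eval_mul, Polynomial.eval_prod,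
      Polynomial.eval_add, Polynomial.eval_X, Polynomial.eval_C]
    rw [Finset.prod_eq_zero (Finset.mem_erase.2 ⟨hsr.symm, hr⟩) (by simp), mul_zero]

/-- The function `r ↦ r ^ (i t)` on the positive reals, with value `0` at `0`. -/
noncomputable def imagPow (t : ℝ) (r : ℝ) : ℂ :=
  if r = 0 then 0 else Complex.exp (t * Real.log r * Complex.I)

/-- Distinct characters of `ℝ` are linearly independent. -/
theorem spansOnFinite_imagPow : SpansOnFinite imagPow := by
  intro F hF c h r hr
  let χ : ℝ → (Multiplicative ℝ →* ℂ) := fun r =>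
    { toFun := fun t => Complex.exp ((t.toAdd : ℝ) * Real.log r * Complex.I)
      map_one' := by simp
      map_mul' := fun s t => by
        rw [← Complex.exp_add]
        congr 1
        simp only [toAdd_mul]
        push_cast
        ring }
  have hinj : Function.Injective (fun r : F => χ r) := by
    rintro ⟨a, ha⟩ ⟨b, hb⟩ hab
    have hlog : Real.log a = Real.log b := by
      by_contra hne
      have hne' : Real.log a - Real.log b ≠ 0 := sub_ne_zero.2 hne
      have h1 := DFunLike.congr_fun hab
        (Multiplicative.ofAdd (Real.pi / (Real.log a - Real.log b)))
      simp only [MonoidHom.coe_mk, OneHom.coe_mk, toAdd_ofAdd, χ] at h1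
      have h2 : ((Real.pi / (Real.log a - Real.log b) : ℝ) : ℂ) * Real.log a * Complex.I =
          ((Real.pi / (Real.log a - Real.log b) : ℝ) : ℂ) * Real.log b * Complex.I
            + Real.pi * Complex.I := by
        have : Real.pi / (Real.log a - Real.log b) * Real.log a =
            Real.pi / (Real.log a - Real.log b) * Real.log b + Real.pi := by
          field_simp
          ring
        rw [← add_mul]
        congr 1
        exact_mod_cast this
      rw [h2, Complex.exp_add, Complex.exp_pi_mul_I, mul_neg_one] at h1
      exact Complex.exp_ne_zero _ (self_eq_neg.1 h1.symm)
    exact Subtype.ext (Real.log_injOn_pos (hF a ha) (hF b hb) hlog)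
  have hli := (linearIndependent_monoidHom (Multiplicative ℝ) ℂ).comp _ hinj
  rw [Fintype.linearIndependent_iff] at hli
  refine hli (fun r => c r) ?_ ⟨r, hr⟩
  ext t
  have h1 := h t.toAdd
  rw [← Finset.sum_coe_sort] at h1
  simp only [Finset.sum_apply, Pi.smul_apply, smul_eq_mul, Function.comp_apply, Pi.zero_apply]
  rw [← h1]
  refine Finset.sum_congr rfl fun s _ => ?_
  rw [mul_comm, imagPow, if_neg (hF s s.2).ne']
  rfl

/-! ### Compatible pairs -/

/-- The pair `A'`, `B'` has, on the support of `B'`, the same functions of the ratio as the pair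
`A`, `B`. This is the condition shared by all the equality conditions. -/
def RatioCompatible (A B A' B' : Matrix (Fin d) (Fin d) ℂ) : Prop :=
  ∀ f : ℝ → ℂ, f 0 = 0 → ratioCalc f A' B' = ratioCalc f A B * supportProj B'

/-- Compatibility can be tested on any family that spans all functions on finite sets. -/
theorem ratioCompatible_of_spansOnFinite {A' B' : Matrix (Fin d) (Fin d) ℂ}
    (h : SupportedPair A B) (h' : SupportedPair A' B') {ι : Type*} {g : ι → ℝ → ℂ}
    (hg : SpansOnFinite g) (hg0 : ∀ i, g i 0 = 0)
    (H : ∀ i, ratioCalc (g i) A' B' = ratioCalc (g i) A B * supportProj B') :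
    RatioCompatible A B A' B' := by
  have hF : ∀ r ∈ ratioSet A B ∪ ratioSet A' B', 0 < r := by
    intro r hr
    rcases Finset.mem_union.1 hr with hr | hr
    · exact ratioSet_pos h hr
    · exact ratioSet_pos h' hr
  have hdiff : ∀ f : ℝ → ℂ, f 0 = 0 →
      ∑ r ∈ ratioSet A B ∪ ratioSet A' B',
        f r • (ratioPart A' B' r - ratioPart A B r * supportProj B') =
      ratioCalc f A' B' - ratioCalc f A B * supportProj B' := by
    intro f hf
    rw [ratioCalc_eq_sum hf Finset.subset_union_left hF,
      ratioCalc_eq_sum hf Finset.subset_union_right hF, Finset.sum_mul, ← Finset.sum_sub_distrib]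
    simp only [smul_sub, smul_mul_assoc]
  have hzero : ∀ r ∈ ratioSet A B ∪ ratioSet A' B',
      ratioPart A' B' r - ratioPart A B r * supportProj B' = 0 := fun r hr =>
    hg.eq_zero hF (fun i => by rw [hdiff _ (hg0 i), H i, sub_self]) hr
  intro f hf
  rw [← sub_eq_zero, ← hdiff f hf]
  exact Finset.sum_eq_zero fun r hr => by rw [hzero r hr, smul_zero]

theorem matPowI_mul_matPowI (h : SupportedPair A B) (t : ℝ) :
    matPowI A t * matPowI B (-t) = ratioCalc (imagPow t) A B := by
  rw [matPowI_eq_funCalc, matPowI_eq_funCalc, funCalc_mul_funCalc]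
  refine (ratioCalc_eq_jointCalc h (by simp [imagPow]) (by simp) fun x y hx hy => ?_).symm
  rcases hx.eq_or_lt with rfl | hx
  · simp [imagPow]
  · rw [imagPow, if_neg (div_pos hx hy).ne', if_neg hx.ne', if_neg hy.ne', ← Complex.exp_add,
      Real.log_div hx.ne' hy.ne']
    congr 1
    push_cast
    ring

/-- The condition on imaginary powers is equivalent to compatibility. -/
theorem ratioCompatible_iff_matPowI {A' B' : Matrix (Fin d) (Fin d) ℂ} (h : SupportedPair A B)
    (h' : SupportedPair A' B') :
    RatioCompatible A B A' B' ↔ ∀ t : ℝ,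
      matPowI A' t * matPowI B' (-t) = matPowI A t * matPowI B (-t) * supportProj B' := by
  simp only [matPowI_mul_matPowI h, matPowI_mul_matPowI h']
  constructor
  · intro H t
    exact H _ (by simp [imagPow])
  · exact ratioCompatible_of_spansOnFinite h h' spansOnFinite_imagPow (by simp [imagPow])

end RatioCalculus

namespace RatioCalculus

open MeasureTheory Set Filter Topology

/-! ### An integral representation of the entropy functions -/

/-- The function `f_p` with `J_p(I, x, y) = y f_p(x / y)` for numbers `x ≥ 0`, `y > 0`. -/
noncomputable def entropyFun (p z : ℝ) : ℝ :=
  if p = 1 then z * Real.log z else 1 / (p * (1 - p)) * (z - z ^ p)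

/-- The condition `0 < p` gives integrability at `0`, and `p < 2` gives integrability at `∞`. -/
theorem integrableOn_rpow_div_one_add_sq {p : ℝ} (hp : p ∈ Ioo (0 : ℝ) 2) :
    IntegrableOn (fun t : ℝ => t ^ (p - 1) * ((1 + t) ^ 2)⁻¹) (Ioi 0) := by
  have hcont : ContinuousOn (fun t : ℝ => t ^ (p - 1) * ((1 + t) ^ 2)⁻¹) (Ioi 0) := by
    intro t ht
    have ht' : (0 : ℝ) < t := ht
    refine ContinuousAt.continuousWithinAt ?_
    refine (Real.continuousAt_rpow_const t _ (Or.inl ht'.ne')).mul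
      (ContinuousAt.inv₀ (by fun_prop) ?_)
    positivity
  rw [← Ioc_union_Ioi_eq_Ioi zero_le_one]
  refine IntegrableOn.union ?_ ?_
  · have h1 : IntegrableOn (fun t : ℝ => t ^ (p - 1)) (Ioc 0 1) := by
      rw [← intervalIntegrable_iff_integrableOn_Ioc_of_le zero_le_one]
      exact intervalIntegral.intervalIntegrable_rpow' (by linarith [hp.1])
    refine Integrable.mono' h1
      ((hcont.mono Ioc_subset_Ioi_self).aestronglyMeasurable measurableSet_Ioc) ?_
    refine (ae_restrict_iff' measurableSet_Ioc).2 (Eventually.of_forall fun t ht => ?_)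
    have h0 : 0 ≤ t ^ (p - 1) := Real.rpow_nonneg ht.1.le _
    have h2 : ((1 + t) ^ 2)⁻¹ ≤ 1 := inv_le_one_of_one_le₀ (by nlinarith [ht.1])
    have h3 : 0 ≤ ((1 + t) ^ 2)⁻¹ := by positivity
    rw [Real.norm_of_nonneg (mul_nonneg h0 h3)]
    exact mul_le_of_le_one_right h0 h2
  · have h1 : IntegrableOn (fun t : ℝ => t ^ (p - 3)) (Ioi 1) :=
      integrableOn_Ioi_rpow_of_lt (by linarith [hp.2]) zero_lt_one
    refine Integrable.mono' h1
      ((hcont.mono (Ioi_subset_Ioi zero_le_one)).aestronglyMeasurable measurableSet_Ioi) ?_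
    refine (ae_restrict_iff' measurableSet_Ioi).2 (Eventually.of_forall fun t ht => ?_)
    have ht0 : 0 < t := zero_lt_one.trans ht
    have h0 : 0 ≤ t ^ (p - 1) := Real.rpow_nonneg ht0.le _
    have h3 : 0 ≤ ((1 + t) ^ 2)⁻¹ := by positivity
    rw [Real.norm_of_nonneg (mul_nonneg h0 h3)]
    have h4 : t ^ (p - 3) = t ^ (p - 1) * (t ^ 2)⁻¹ := by
      rw [← Real.rpow_natCast t 2, ← Real.rpow_neg ht0.le, ← Real.rpow_add ht0]
      congr 1
      push_cast
      ring
    rw [h4]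
    gcongr
    linarith

theorem integrableOn_resolvent_diff {p : ℝ} (hp : p ∈ Ioo (0 : ℝ) 2) {a z : ℝ} (ha : 0 < a)
    (hz : 0 < z) :
    IntegrableOn (fun t : ℝ => t ^ (p - 1) * (1 / (a + t) - 1 / (z + t))) (Ioi 0) := by
  -- `min 1 b * (1 + t) ≤ b + t` bounds the integrand by a multiple of `t ^ (p - 1) / (1 + t) ^ 2`.
  set m := min 1 a * min 1 z with hm
  have hm0 : 0 < m := mul_pos (lt_min one_pos ha) (lt_min one_pos hz)
  have h1 := (integrableOn_rpow_div_one_add_sq hp).const_mul (|z - a| / m)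
  refine Integrable.mono' h1 ?_ ?_
  · refine ContinuousOn.aestronglyMeasurable ?_ measurableSet_Ioi
    intro t ht
    have ht' : (0 : ℝ) < t := ht
    refine ContinuousAt.continuousWithinAt ?_
    refine (Real.continuousAt_rpow_const t _ (Or.inl ht'.ne')).mul ?_
    refine ContinuousAt.sub ?_ ?_
    · exact ContinuousAt.div (by fun_prop) (by fun_prop) (by positivity)
    · exact ContinuousAt.div (by fun_prop) (by fun_prop) (by positivity)
  · refine (ae_restrict_iff' measurableSet_Ioi).2 (Eventually.of_forall fun t ht => ?_)
    have ht0 : (0 : ℝ) < t := ht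
    have e : t ^ (p - 1) * (1 / (a + t) - 1 / (z + t)) =
        t ^ (p - 1) * ((z - a) / ((a + t) * (z + t))) := by
      congr 1
      field_simp
      ring
    have hlow : ∀ b : ℝ, 0 < b → min 1 b * (1 + t) ≤ b + t := by
      intro b hb
      have h1 := min_le_left 1 b
      have h2 := min_le_right 1 b
      nlinarith
    have hlow2 : m * (1 + t) ^ 2 ≤ (a + t) * (z + t) := by
      calc m * (1 + t) ^ 2 = (min 1 a * (1 + t)) * (min 1 z * (1 + t)) := by rw [hm]; ring
        _ ≤ _ := mul_le_mul (hlow a ha) (hlow z hz)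
          (mul_nonneg (lt_min one_pos hz).le (by positivity)) (by positivity)
    rw [e, norm_mul, norm_div, Real.norm_of_nonneg (Real.rpow_nonneg ht0.le _), Real.norm_eq_abs,
      Real.norm_of_nonneg (by positivity : 0 ≤ (a + t) * (z + t))]
    calc t ^ (p - 1) * (|z - a| / ((a + t) * (z + t)))
        ≤ t ^ (p - 1) * (|z - a| / (m * (1 + t) ^ 2)) := by gcongr
      _ = |z - a| / m * (t ^ (p - 1) * ((1 + t) ^ 2)⁻¹) := by
        field_simp

/-- The integral `∫ t ^ (p - 1) (1 / (1 + t) - 1 / (z + t)) dt` over the positive reals. -/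
noncomputable def resolventIntegral (p z : ℝ) : ℝ :=
  ∫ t in Ioi (0 : ℝ), t ^ (p - 1) * (1 / (1 + t) - 1 / (z + t))

/-- The substitution `t = x s` gives a cocycle identity, which determines the integral up to a
factor when `p ≠ 1`. -/
theorem resolventIntegral_mul {p : ℝ} (hp : p ∈ Ioo (0 : ℝ) 2) {x y : ℝ} (hx : 0 < x)
    (hy : 0 < y) :
    resolventIntegral p (x * y) = resolventIntegral p x + x ^ (p - 1) * resolventIntegral p y := by
  have h1 : resolventIntegral p (x * y) - resolventIntegral p x =
      ∫ t in Ioi (0 : ℝ), t ^ (p - 1) * (1 / (x + t) - 1 / (x * y + t)) := by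
    unfold resolventIntegral
    rw [← integral_sub (integrableOn_resolvent_diff hp one_pos (mul_pos hx hy))
      (integrableOn_resolvent_diff hp one_pos hx)]
    refine integral_congr_ae (Eventually.of_forall fun t => ?_)
    simp only
    ring
  have h2 := integral_comp_mul_left_Ioi
    (fun t : ℝ => t ^ (p - 1) * (1 / (x + t) - 1 / (x * y + t))) 0 hx
  rw [mul_zero, smul_eq_mul] at h2
  have h3 : ∫ s in Ioi (0 : ℝ), (x * s) ^ (p - 1) * (1 / (x + x * s) - 1 / (x * y + x * s)) =
      x⁻¹ * (x ^ (p - 1) * resolventIntegral p y) := by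
    unfold resolventIntegral
    rw [← integral_const_mul, ← integral_const_mul]
    refine setIntegral_congr_fun measurableSet_Ioi fun s hs => ?_
    have hs' : (0 : ℝ) < s := hs
    rw [Real.mul_rpow hx.le hs'.le]
    field_simp
  rw [h3] at h2
  have h4 := mul_left_cancel₀ (inv_ne_zero hx.ne') h2
  linarith

theorem resolventIntegral_two_pos {p : ℝ} (hp : p ∈ Ioo (0 : ℝ) 2) :
    0 < resolventIntegral p 2 := by
  have hpos : ∀ t : ℝ, 0 < t → 0 < t ^ (p - 1) * (1 / (1 + t) - 1 / (2 + t)) := by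
    intro t ht
    refine mul_pos (Real.rpow_pos_of_pos ht _) (sub_pos.2 ?_)
    exact one_div_lt_one_div_of_lt (by linarith) (by linarith)
  unfold resolventIntegral
  rw [setIntegral_pos_iff_support_of_nonneg_ae]
  · have : Function.support (fun t : ℝ => t ^ (p - 1) * (1 / (1 + t) - 1 / (2 + t))) ∩ Ioi 0
        = Ioi 0 := by
      rw [inter_eq_right]
      exact fun t ht => (hpos t ht).ne'
    rw [this, Real.volume_Ioi]
    exact ENNReal.zero_lt_top
  · exact (ae_restrict_iff' measurableSet_Ioi).2 (Eventually.of_forall fun t ht => (hpos t ht).le)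
  · exact integrableOn_resolvent_diff hp one_pos two_pos

theorem resolventIntegral_one {z : ℝ} (hz : 0 < z) : resolventIntegral 1 z = Real.log z := by
  have hint := integrableOn_resolvent_diff (p := 1) ⟨one_pos, one_lt_two⟩ one_pos hz
  have hderiv : ∀ t ∈ Ici (0 : ℝ), HasDerivAt (fun t => Real.log ((1 + t) / (z + t)))
      (t ^ ((1 : ℝ) - 1) * (1 / (1 + t) - 1 / (z + t))) t := by
    intro t ht
    have ht' : (0 : ℝ) ≤ t := ht
    have h1 : HasDerivAt (fun t : ℝ => 1 + t) 1 t := (hasDerivAt_id t).const_add 1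
    have h2 : HasDerivAt (fun t : ℝ => z + t) 1 t := (hasDerivAt_id t).const_add z
    have h3 : (1 + t) ≠ 0 := by positivity
    have h4 : (z + t) ≠ 0 := by positivity
    refine ((h1.fun_div h2 h4).log (div_ne_zero h3 h4)).congr_deriv ?_
    rw [sub_self, Real.rpow_zero]
    field_simp
  have hlim : Tendsto (fun t => Real.log ((1 + t) / (z + t))) atTop (𝓝 0) := by
    rw [← Real.log_one]
    refine (Real.continuousAt_log one_ne_zero).tendsto.comp ?_
    have h1 : Tendsto (fun t : ℝ => (1 - z) / (z + t)) atTop (𝓝 0) :=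
      tendsto_const_nhds.div_atTop (tendsto_atTop_add_const_left _ _ tendsto_id)
    have h2 : Tendsto (fun t : ℝ => 1 + (1 - z) / (z + t)) atTop (𝓝 1) := by
      simpa using h1.const_add 1
    refine h2.congr' ?_
    filter_upwards [eventually_gt_atTop 0] with t ht
    field_simp
    ring
  unfold resolventIntegral
  rw [integral_Ioi_of_hasDerivAt_of_tendsto' hderiv hint hlim]
  simp [Real.log_inv]

/-- `f_p` is a positive multiple of `∫ t ^ (p - 1) (z / (1 + t) - z / (z + t)) dt`. -/
theorem exists_entropyFun_eq_integral {p : ℝ} (hp : p ∈ Ioo (0 : ℝ) 2) :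
    ∃ c : ℝ, 0 < c ∧ ∀ z : ℝ, 0 ≤ z →
      entropyFun p z = c * ∫ t in Ioi (0 : ℝ), t ^ (p - 1) * (z / (1 + t) - z / (z + t)) := by
  have hz0 : entropyFun p 0 = 0 := by
    unfold entropyFun
    split_ifs
    · simp
    · rw [Real.zero_rpow hp.1.ne']; simp
  have hmul : ∀ z : ℝ, ∫ t in Ioi (0 : ℝ), t ^ (p - 1) * (z / (1 + t) - z / (z + t)) =
      z * resolventIntegral p z := by
    intro z
    unfold resolventIntegral
    rw [← integral_const_mul]
    refine integral_congr_ae (Eventually.of_forall fun t => ?_)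
    simp only
    ring
  simp only [hmul]
  by_cases h1 : p = 1
  · subst h1
    refine ⟨1, one_pos, fun z hz => ?_⟩
    rcases hz.eq_or_lt with rfl | hz
    · simp [hz0]
    · simp [entropyFun, resolventIntegral_one hz]
  · have h2 := resolventIntegral_two_pos hp
    have hne : (1 : ℝ) - 2 ^ (p - 1) ≠ 0 := by
      rw [sub_ne_zero]
      intro h
      have h3 := congrArg Real.log h
      rw [Real.log_one, Real.log_rpow two_pos, eq_comm, mul_eq_zero] at h3
      rcases h3 with h3 | h3
      · exact h1 (by linarith)
      · exact (Real.log_pos one_lt_two).ne' h3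
    have hp1 : (1 - p) ≠ 0 := sub_ne_zero.2 (Ne.symm h1)
    have hp0 := hp.1
    refine ⟨(1 - 2 ^ (p - 1)) / (resolventIntegral p 2 * (p * (1 - p))), ?_, fun z hz => ?_⟩
    · rcases lt_or_gt_of_ne h1 with h | h
      · have h3 : (2 : ℝ) ^ (p - 1) < 1 :=
          Real.rpow_lt_one_of_one_lt_of_neg one_lt_two (by linarith)
        exact div_pos (by linarith) (mul_pos h2 (mul_pos hp0 (by linarith)))
      · have h3 : 1 < (2 : ℝ) ^ (p - 1) := Real.one_lt_rpow one_lt_two (by linarith)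
        exact div_pos_of_neg_of_neg (by linarith)
          (mul_neg_of_pos_of_neg h2 (mul_neg_of_pos_of_neg hp0 (by linarith)))
    · rcases hz.eq_or_lt with rfl | hz
      · simp [hz0]
      · have h3 := resolventIntegral_mul hp hz two_pos
        have h4 := resolventIntegral_mul hp two_pos hz
        -- Comparing the cocycle identity for `z * 2` and for `2 * z` gives the value at `z`.
        rw [mul_comm 2 z, h3] at h4
        have h5 : resolventIntegral p z * (1 - 2 ^ (p - 1)) =
            resolventIntegral p 2 * (1 - z ^ (p - 1)) := by linarith
        have h6 : z ^ p = z * z ^ (p - 1) := by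
          rw [mul_comm, ← Real.rpow_add_one hz.ne']
          congr 1
          ring
        rw [entropyFun, if_neg h1, h6]
        have h7 : (1 - 2 ^ (p - 1)) / (resolventIntegral p 2 * (p * (1 - p))) *
            (z * resolventIntegral p z) = z * (resolventIntegral p z * (1 - 2 ^ (p - 1))) /
            (resolventIntegral p 2 * (p * (1 - p))) := by ring
        rw [h7, h5]
        field_simp

theorem integrableOn_entropyKernel {p : ℝ} (hp : p ∈ Ioo (0 : ℝ) 2) {z : ℝ} (hz : 0 ≤ z) :
    IntegrableOn (fun t : ℝ => t ^ (p - 1) * (z / (1 + t) - z / (z + t))) (Ioi 0) := by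
  rcases hz.eq_or_lt with rfl | hz
  · simp
  · refine ((integrableOn_resolvent_diff hp one_pos hz).const_mul z).congr
      (Eventually.of_forall fun t => ?_)
    simp only
    ring

end RatioCalculus

namespace RatioCalculus

open Matrix MeasureTheory

variable {d m : ℕ} {A B : Matrix (Fin d) (Fin d) ℂ}

/-! ### The functional `J_p` as an integral over resolvents -/

theorem entropyFun_zero {p : ℝ} (hp : p ∈ Set.Ioo (0 : ℝ) 2) : entropyFun p 0 = 0 := by
  unfold entropyFun
  split_ifs
  · simp
  · rw [Real.zero_rpow hp.1.ne']; simp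

theorem ratioCalc_mul_right (hB : B.IsHermitian) (f : ℝ → ℂ) :
    ratioCalc f A B * B = jointCalc (fun x y => f (x / y) * y) A B := by
  nth_rw 2 [← funCalc_id hB]
  rw [ratioCalc, jointCalc_mul_funCalc]

theorem left_mul_ratioCalc (hA : A.IsHermitian) (f : ℝ → ℂ) :
    A * ratioCalc f A B = jointCalc (fun x y => x * f (x / y)) A B := by
  nth_rw 1 [← funCalc_id hA]
  rw [ratioCalc, funCalc_mul_jointCalc]

theorem left_eq_jointCalc (hA : A.IsHermitian) (hB : B.IsHermitian) :
    A = jointCalc (fun x _ => (x : ℂ)) A B := by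
  rw [← funCalc_left_eq_jointCalc hB, funCalc_id hA]

/-- The functional `J_p` is the trace of `f_p(L_A R_B⁻¹)(I) B`. -/
theorem Jp_eq_trace (h : SupportedPair A B) {p : ℝ} (hp : p ∈ Set.Ioo (0 : ℝ) 2) :
    Jp p 1 A B = (ratioCalc (fun z => (entropyFun p z : ℂ)) A B * B).trace.re := by
  have hA := h.left.1
  have hB := h.right.1
  rw [ratioCalc_mul_right hB]
  by_cases h1 : p = 1
  · subst h1
    rw [Jp, if_pos rfl]
    simp only [conjTranspose_one, one_mul, mul_one]
    rw [← trace_sub, matLog, matLog, cfc_eq_funCalc, cfc_eq_funCalc, mul_funCalc hA,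
      funCalc_left_eq_jointCalc hB]
    nth_rw 2 [← funCalc_id hA]
    rw [funCalc_mul_funCalc, jointCalc_sub]
    congr 2
    refine jointCalc_congr h.left h.right h.ker_le (by simp) fun x y hx hy => ?_
    rcases hx.eq_or_lt with rfl | hx
    · simp [entropyFun]
    · have : x / y * Real.log (x / y) * y = x * Real.log x - x * Real.log y := by
        rw [Real.log_div hx.ne' hy.ne']
        field_simp
      simp only [entropyFun, if_true]
      exact_mod_cast this.symm
  · rw [Jp, if_neg h1]
    simp only [conjTranspose_one, one_mul, mul_one]
    rw [← trace_sub, matRpow, matRpow, cfc_eq_funCalc, cfc_eq_funCalc, funCalc_mul_funCalc]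
    nth_rw 1 [left_eq_jointCalc hA hB]
    rw [jointCalc_sub, ← Complex.re_ofReal_mul, ← smul_eq_mul, ← trace_smul, jointCalc_smul]
    congr 2
    refine jointCalc_congr h.left h.right h.ker_le ?_ fun x y hx hy => ?_
    · simp [Real.zero_rpow hp.1.ne']
    · have h2 : entropyFun p (x / y) * y = 1 / (p * (1 - p)) * (x - x ^ p * y ^ (1 - p)) := by
        have h3 : (x / y) ^ p * y = x ^ p * y ^ (1 - p) := by
          rw [Real.div_rpow hx hy.le, Real.rpow_sub hy, Real.rpow_one]
          ring
        rw [entropyFun, if_neg h1, mul_assoc, sub_mul, h3, div_mul_cancel₀ _ hy.ne']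
      exact_mod_cast h2.symm

/-- The real part of `Tr P_A(x) P_B(y)`. -/
noncomputable def overlap (A B : Matrix (Fin d) (Fin d) ℂ) (x y : ℝ) : ℝ :=
  (specProj A x * specProj B y).trace.re

theorem re_trace_ratioCalc_mul_right (hB : B.IsHermitian) (f : ℝ → ℝ) :
    (ratioCalc (fun z => (f z : ℂ)) A B * B).trace.re =
      ∑ x ∈ specSet A, ∑ y ∈ specSet B, y * overlap A B x y * f (x / y) := by
  rw [ratioCalc_mul_right hB, jointCalc]
  simp only [trace_sum, trace_smul, Complex.re_sum, smul_eq_mul]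
  refine Finset.sum_congr rfl fun x _ => Finset.sum_congr rfl fun y _ => ?_
  rw [← Complex.ofReal_mul, Complex.re_ofReal_mul, overlap]
  ring

/-- The function `z ↦ z / (z + t)`. -/
noncomputable def resolventFun (t z : ℝ) : ℝ := z / (z + t)

/-- `Tr g_t(L_A R_B⁻¹)(I) B` for `g_t z = z / (z + t)`. This is the value at `(I, I)` of the
parallel sum of `t⁻¹ L_A` and `R_B`. -/
noncomputable def resolventTrace (A B : Matrix (Fin d) (Fin d) ℂ) (t : ℝ) : ℝ :=
  (ratioCalc (fun z => (resolventFun t z : ℂ)) A B * B).trace.re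

theorem trace_eq_sum_overlap (h : SupportedPair A B) :
    A.trace.re = ∑ x ∈ specSet A, ∑ y ∈ specSet B, y * overlap A B x y * (x / y) := by
  rw [← re_trace_ratioCalc_mul_right h.right.1 (fun z => z), ratioCalc_mul_right h.right.1]
  nth_rw 1 [left_eq_jointCalc h.left.1 h.right.1]
  congr 2
  refine jointCalc_congr h.left h.right h.ker_le (by simp) fun x y _ hy => ?_
  have : x = x / y * y := (div_mul_cancel₀ x hy.ne').symm
  exact_mod_cast this

/-- The integrand of the integral representation of `J_p`, as a combination of scalar integrands. -/
theorem kernel_eq_sum_overlap (h : SupportedPair A B) (p t : ℝ) :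
    t ^ (p - 1) * (A.trace.re / (1 + t) - resolventTrace A B t) =
      ∑ x ∈ specSet A, ∑ y ∈ specSet B, y * overlap A B x y *
        (t ^ (p - 1) * (x / y / (1 + t) - x / y / (x / y + t))) := by
  rw [trace_eq_sum_overlap h, resolventTrace, re_trace_ratioCalc_mul_right h.right.1,
    Finset.sum_div, ← Finset.sum_sub_distrib, Finset.mul_sum]
  refine Finset.sum_congr rfl fun x _ => ?_
  rw [Finset.sum_div, ← Finset.sum_sub_distrib, Finset.mul_sum]
  refine Finset.sum_congr rfl fun y _ => ?_
  rw [resolventFun]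
  ring

theorem integrableOn_kernel (h : SupportedPair A B) {p : ℝ} (hp : p ∈ Set.Ioo (0 : ℝ) 2) :
    IntegrableOn (fun t : ℝ => t ^ (p - 1) * (A.trace.re / (1 + t) - resolventTrace A B t))
      (Set.Ioi 0) := by
  simp only [kernel_eq_sum_overlap h]
  exact integrable_finsetSum _ fun x hx => integrable_finsetSum _ fun y hy =>
    (integrableOn_entropyKernel hp
      (div_nonneg (specSet_nonneg h.left hx) (specSet_nonneg h.right hy))).const_mul _

/-- The constant depends only on `p`, so that values of `J_p` at several pairs can be compared
under one integral. -/
theorem exists_Jp_eq_integral {p : ℝ} (hp : p ∈ Set.Ioo (0 : ℝ) 2) :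
    ∃ c : ℝ, 0 < c ∧ ∀ A B : Matrix (Fin d) (Fin d) ℂ, SupportedPair A B →
      Jp p 1 A B = c * ∫ t in Set.Ioi (0 : ℝ),
        t ^ (p - 1) * (A.trace.re / (1 + t) - resolventTrace A B t) := by
  obtain ⟨c, hc, H⟩ := exists_entropyFun_eq_integral hp
  refine ⟨c, hc, fun A B h => ?_⟩
  rw [Jp_eq_trace h hp, re_trace_ratioCalc_mul_right h.right.1]
  simp only [kernel_eq_sum_overlap h]
  have hint : ∀ x ∈ specSet A, ∀ y ∈ specSet B, IntegrableOn (fun t : ℝ =>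
      y * overlap A B x y * (t ^ (p - 1) * (x / y / (1 + t) - x / y / (x / y + t))))
      (Set.Ioi 0) := fun x hx y hy => (integrableOn_entropyKernel hp
      (div_nonneg (specSet_nonneg h.left hx) (specSet_nonneg h.right hy))).const_mul _
  rw [integral_finsetSum _ fun x hx => integrable_finsetSum _ fun y hy => hint x hx y hy,
    Finset.mul_sum]
  refine Finset.sum_congr rfl fun x hx => ?_
  rw [integral_finsetSum _ fun y hy => hint x hx y hy, Finset.mul_sum]
  refine Finset.sum_congr rfl fun y hy => ?_
  rw [integral_const_mul,
    H _ (div_nonneg (specSet_nonneg h.left hx) (specSet_nonneg h.right hy))]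
  ring

theorem continuousOn_resolventTrace (h : SupportedPair A B) :
    ContinuousOn (resolventTrace A B) (Set.Ioi 0) := by
  have : resolventTrace A B = fun t => ∑ x ∈ specSet A, ∑ y ∈ specSet B,
      y * overlap A B x y * resolventFun t (x / y) := by
    ext t
    rw [resolventTrace, re_trace_ratioCalc_mul_right h.right.1]
  rw [this]
  refine continuousOn_finsetSum _ fun x hx => continuousOn_finsetSum _ fun y hy => ?_
  refine continuousOn_const.mul ?_
  refine continuousOn_const.div (by fun_prop) fun t ht => ?_
  have h1 := div_nonneg (specSet_nonneg h.left hx) (specSet_nonneg h.right hy)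
  have ht' : (0 : ℝ) < t := ht
  positivity

/-! ### The variational characterization of the resolvent trace -/

/-- The resolvent `X = g_t(L_A R_B⁻¹)(I)` solves the Sylvester equation `A X + t X B = A`. -/
theorem ratioCalc_resolvent_sylvester (h : SupportedPair A B) {t : ℝ} (ht : 0 < t) :
    A * ratioCalc (fun z => (resolventFun t z : ℂ)) A B +
      (t : ℂ) • (ratioCalc (fun z => (resolventFun t z : ℂ)) A B * B) = A := by
  rw [left_mul_ratioCalc h.left.1, ratioCalc_mul_right h.right.1, jointCalc_smul, jointCalc_add]
  nth_rw 2 [left_eq_jointCalc h.left.1 h.right.1]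
  refine jointCalc_congr h.left h.right h.ker_le (by simp) fun x y hx hy => ?_
  have : x * resolventFun t (x / y) + t * (resolventFun t (x / y) * y) = x := by
    have h1 : x / y + t ≠ 0 := by positivity
    unfold resolventFun
    have h2 : x + y * t ≠ 0 := by positivity
    field_simp
  exact_mod_cast this

/-- With `S` the square root of `B`, the hypothesis says `(Z S) (Z S)ᴴ = 0`. -/
theorem mul_eq_zero_of_mul_mul_conjTranspose_eq_zero (hB : B.PosSemidef)
    {Z : Matrix (Fin d) (Fin d) ℂ} (h : Z * B * Zᴴ = 0) : Z * B = 0 := by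
  have hS : funCalc (fun x => ((Real.sqrt x : ℝ) : ℂ)) B *
      funCalc (fun x => ((Real.sqrt x : ℝ) : ℂ)) B = B := by
    rw [funCalc_mul]
    nth_rw 2 [← funCalc_id hB.1]
    refine funCalc_congr fun x hx => ?_
    exact_mod_cast Real.mul_self_sqrt (specSet_nonneg hB hx)
  have hS' : (funCalc (fun x => ((Real.sqrt x : ℝ) : ℂ)) B)ᴴ =
      funCalc (fun x => ((Real.sqrt x : ℝ) : ℂ)) B := by
    rw [conjTranspose_funCalc]
    simp
  set S := funCalc (fun x => ((Real.sqrt x : ℝ) : ℂ)) B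
  have h1 : (Z * S) * (Z * S)ᴴ = 0 := by
    rw [conjTranspose_mul, hS', ← h, ← hS]
    simp only [mul_assoc]
  rw [self_mul_conjTranspose_eq_zero] at h1
  rw [← hS, ← mul_assoc, h1, zero_mul]

/-- Uniqueness for the Sylvester equation, up to the kernel of `B`. -/
theorem eq_zero_of_homogeneous_sylvester (hA : A.PosSemidef) (hB : B.PosSemidef) {t : ℝ}
    (ht : 0 < t) {Z : Matrix (Fin d) (Fin d) ℂ} (h : A * Z + (t : ℂ) • (Z * B) = 0) :
    Z * B = 0 := by
  apply mul_eq_zero_of_mul_mul_conjTranspose_eq_zero hB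
  have h1 := hA.conjTranspose_mul_mul_same Z
  have h2 := hB.mul_mul_conjTranspose_same Z
  rw [← h2.trace_eq_zero_iff]
  have h3 : (Zᴴ * A * Z).trace + t * (Z * B * Zᴴ).trace = 0 := by
    have := congrArg (fun M => (Zᴴ * M).trace) h
    simp only [mul_add, mul_smul_comm, trace_add, trace_smul, mul_zero, trace_zero,
      smul_eq_mul] at this
    rw [trace_mul_comm Zᴴ (Z * B)] at this
    rw [← this, ← mul_assoc]
  have h4 := h1.trace_nonneg
  have h5 := h2.trace_nonneg
  have ht' : (0 : ℂ) < t := by exact_mod_cast ht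
  have h6 : (t : ℂ) * (Z * B * Zᴴ).trace ≤ 0 := by
    rw [← h3]
    exact le_add_of_nonneg_left h4
  have h7 := le_antisymm h6 (mul_nonneg ht'.le h5)
  exact (mul_eq_zero.1 h7).resolve_left ht'.ne'

/-- The resolvent, cut down to the support of `B`, is determined by the Sylvester equation. -/
theorem ratioCalc_resolvent_eq (h : SupportedPair A B) {t : ℝ} (ht : 0 < t)
    {X : Matrix (Fin d) (Fin d) ℂ} (hX : A * X + (t : ℂ) • (X * B) = A) :
    ratioCalc (fun z => (resolventFun t z : ℂ)) A B = X * supportProj B := by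
  have h1 := ratioCalc_resolvent_sylvester h ht
  have h2 : A * (ratioCalc (fun z => (resolventFun t z : ℂ)) A B - X) +
      (t : ℂ) • ((ratioCalc (fun z => (resolventFun t z : ℂ)) A B - X) * B) = 0 := by
    rw [mul_sub, sub_mul, smul_sub, ← sub_eq_zero.2 (h1.trans hX.symm)]
    abel
  have h3 := mul_supportProj_eq_zero h.right.1
    (eq_zero_of_homogeneous_sylvester h.left h.right ht h2)
  rwa [sub_mul, sub_eq_zero, ratioCalc_mul_supportProj h (by simp [resolventFun])] at h3

/-- The quadratic form whose minimum over `X` is `t` times the resolvent trace. -/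
noncomputable def parallelForm (t : ℝ) (A B X : Matrix (Fin d) (Fin d) ℂ) : ℂ :=
  ((1 - X)ᴴ * A * (1 - X)).trace + t * (X * B * Xᴴ).trace

theorem parallelForm_sum (t : ℝ) (A B : Fin m → Matrix (Fin d) (Fin d) ℂ)
    (X : Matrix (Fin d) (Fin d) ℂ) :
    parallelForm t (∑ j, A j) (∑ j, B j) X = ∑ j, parallelForm t (A j) (B j) X := by
  simp only [parallelForm, Finset.mul_sum, Finset.sum_mul, trace_sum, Finset.sum_add_distrib]

/-- Completing the square in the quadratic form around a solution `Y` of the Sylvester equation. -/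
theorem parallelForm_eq (hA : A.IsHermitian) (hB : B.IsHermitian) {t : ℝ}
    {Y : Matrix (Fin d) (Fin d) ℂ} (hY : A * Y + (t : ℂ) • (Y * B) = A)
    (X : Matrix (Fin d) (Fin d) ℂ) :
    parallelForm t A B X = t * (Y * B).trace + ((X - Y)ᴴ * A * (X - Y)).trace +
      t * ((X - Y) * B * (X - Y)ᴴ).trace := by
  obtain ⟨Z, rfl⟩ : ∃ Z, X = Y + Z := ⟨X - Y, by abel⟩
  have e1 : A * (1 - Y) = (t : ℂ) • (Y * B) := by
    rw [mul_sub, mul_one, sub_eq_iff_eq_add']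
    exact hY.symm
  have e2 : (1 - Y)ᴴ * A = (t : ℂ) • (B * Yᴴ) := by
    have := congrArg conjTranspose e1
    simpa [conjTranspose_mul, conjTranspose_smul, hA.eq, hB.eq] using this
  have e3 : (1 - (Y + Z))ᴴ * A * (1 - (Y + Z)) = (1 - Y)ᴴ * (A * (1 - Y)) - Zᴴ * (A * (1 - Y))
      - ((1 - Y)ᴴ * A) * Z + Zᴴ * A * Z := by
    rw [← sub_sub, conjTranspose_sub (1 - Y)]
    noncomm_ring
  have e4 : (Y + Z) * B * (Y + Z)ᴴ = Y * B * Yᴴ + Y * B * Zᴴ + Z * (B * Yᴴ) + Z * B * Zᴴ := by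
    rw [conjTranspose_add]
    noncomm_ring
  have e5 : (1 - Y)ᴴ * (Y * B) = Y * B - Yᴴ * (Y * B) := by
    rw [conjTranspose_sub, conjTranspose_one, sub_mul, one_mul]
  rw [parallelForm, add_sub_cancel_left, e3, e4, e1, e2]
  simp only [mul_smul_comm, smul_mul_assoc, e5, trace_add, trace_sub, trace_smul, smul_eq_mul]
  rw [trace_mul_comm Yᴴ (Y * B), trace_mul_comm Zᴴ (Y * B), trace_mul_comm Z (B * Yᴴ)]
  ring

theorem parallelForm_resolvent (h : SupportedPair A B) {t : ℝ} (ht : 0 < t) :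
    (parallelForm t A B (ratioCalc (fun z => (resolventFun t z : ℂ)) A B)).re =
      t * resolventTrace A B t := by
  rw [parallelForm_eq h.left.1 h.right.1 (ratioCalc_resolvent_sylvester h ht)]
  simp [resolventTrace]

theorem le_parallelForm (h : SupportedPair A B) {t : ℝ} (ht : 0 < t)
    (X : Matrix (Fin d) (Fin d) ℂ) : t * resolventTrace A B t ≤ (parallelForm t A B X).re := by
  rw [parallelForm_eq h.left.1 h.right.1 (ratioCalc_resolvent_sylvester h ht), Complex.add_re,
    Complex.add_re, Complex.re_ofReal_mul, Complex.re_ofReal_mul]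
  have h1 := (Complex.le_def.1 (h.left.conjTranspose_mul_mul_same
    (X - ratioCalc (fun z => (resolventFun t z : ℂ)) A B)).trace_nonneg).1
  have h2 := (Complex.le_def.1 (h.right.mul_mul_conjTranspose_same
    (X - ratioCalc (fun z => (resolventFun t z : ℂ)) A B)).trace_nonneg).1
  rw [Complex.zero_re] at h1 h2
  unfold resolventTrace
  nlinarith [mul_nonneg ht.le h2]

/-- The minimizer of the quadratic form is unique on the support of `B`. -/
theorem resolvent_eq_of_parallelForm_eq (h : SupportedPair A B) {t : ℝ} (ht : 0 < t)
    {X : Matrix (Fin d) (Fin d) ℂ} (hX : (parallelForm t A B X).re = t * resolventTrace A B t) :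
    ratioCalc (fun z => (resolventFun t z : ℂ)) A B = X * supportProj B := by
  rw [parallelForm_eq h.left.1 h.right.1 (ratioCalc_resolvent_sylvester h ht), Complex.add_re,
    Complex.add_re, Complex.re_ofReal_mul, Complex.re_ofReal_mul, resolventTrace] at hX
  have h1 := (Complex.le_def.1 (h.left.conjTranspose_mul_mul_same
    (X - ratioCalc (fun z => (resolventFun t z : ℂ)) A B)).trace_nonneg).1
  have h0 := h.right.mul_mul_conjTranspose_same
    (X - ratioCalc (fun z => (resolventFun t z : ℂ)) A B)
  have h2 := Complex.le_def.1 h0.trace_nonneg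
  rw [Complex.zero_re] at h1 h2
  have h3 : t * ((X - ratioCalc (fun z => (resolventFun t z : ℂ)) A B) * B *
      (X - ratioCalc (fun z => (resolventFun t z : ℂ)) A B)ᴴ).trace.re = 0 :=
    le_antisymm (by linarith) (mul_nonneg ht.le h2.1)
  have h4 := (mul_eq_zero.1 h3).resolve_left ht.ne'
  have h5 := h0.trace_eq_zero_iff.1 (Complex.ext h4 h2.2.symm)
  have h6 := mul_supportProj_eq_zero h.right.1
    (mul_eq_zero_of_mul_mul_conjTranspose_eq_zero h.right h5)
  rw [sub_mul, sub_eq_zero, ratioCalc_mul_supportProj h (by simp [resolventFun])] at h6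
  exact h6.symm

/-! ### Sums of pairs and the equality case -/

theorem matKer_sum_le {B : Fin m → Matrix (Fin d) (Fin d) ℂ} (hB : ∀ j, (B j).PosSemidef)
    (j : Fin m) : matKer (∑ k, B k) ≤ matKer (B j) := by
  rw [matKer_le_iff]
  intro v hv
  rw [← (hB j).dotProduct_mulVec_zero_iff]
  have h1 : ∑ k, star v ⬝ᵥ (B k *ᵥ v) = 0 := by
    rw [← dotProduct_sum, ← sum_mulVec, hv, dotProduct_zero]
  exact (Finset.sum_eq_zero_iff_of_nonneg fun k _ => (hB k).dotProduct_mulVec_nonneg v).1 h1 j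
    (Finset.mem_univ j)

theorem supportedPair_sum {A B : Fin m → Matrix (Fin d) (Fin d) ℂ}
    (h : ∀ j, SupportedPair (A j) (B j)) : SupportedPair (∑ j, A j) (∑ j, B j) where
  left := posSemidef_sum _ fun j _ => (h j).left
  right := posSemidef_sum _ fun j _ => (h j).right
  ker_le := by
    rw [matKer_le_iff]
    intro v hv
    rw [sum_mulVec]
    refine Finset.sum_eq_zero fun j _ => ?_
    exact matKer_le_iff.1 (h j).ker_le v
      (matKer_le_iff.1 (matKer_sum_le (fun k => (h k).right) j) v hv)

/-- The minimizer of the form for the sums is a competitor for each of the pairs. -/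
theorem sum_resolventTrace_le {A B : Fin m → Matrix (Fin d) (Fin d) ℂ}
    (h : ∀ j, SupportedPair (A j) (B j)) {t : ℝ} (ht : 0 < t) :
    ∑ j, resolventTrace (A j) (B j) t ≤ resolventTrace (∑ j, A j) (∑ j, B j) t := by
  have h1 := parallelForm_resolvent (supportedPair_sum h) ht
  rw [parallelForm_sum, Complex.re_sum] at h1
  refine le_of_mul_le_mul_left ?_ ht
  rw [← h1, Finset.mul_sum]
  exact Finset.sum_le_sum fun j _ => le_parallelForm (h j) ht _

theorem resolvent_eq_of_sum_resolventTrace_eq {A B : Fin m → Matrix (Fin d) (Fin d) ℂ}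
    (h : ∀ j, SupportedPair (A j) (B j)) {t : ℝ} (ht : 0 < t)
    (heq : ∑ j, resolventTrace (A j) (B j) t = resolventTrace (∑ j, A j) (∑ j, B j) t)
    (j : Fin m) :
    ratioCalc (fun z => (resolventFun t z : ℂ)) (A j) (B j) =
      ratioCalc (fun z => (resolventFun t z : ℂ)) (∑ k, A k) (∑ k, B k) *
        supportProj (B j) := by
  have h1 := parallelForm_resolvent (supportedPair_sum h) ht
  rw [parallelForm_sum, Complex.re_sum, ← heq, Finset.mul_sum] at h1
  have h2 := (Finset.sum_eq_sum_iff_of_le fun j _ => le_parallelForm (h j) ht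
    (ratioCalc (fun z => (resolventFun t z : ℂ)) (∑ k, A k) (∑ k, B k))).1 h1.symm
  exact resolvent_eq_of_parallelForm_eq (h j) ht (h2 j (Finset.mem_univ j)).symm

theorem ratioCompatible_of_resolvent {A' B' : Matrix (Fin d) (Fin d) ℂ} (h : SupportedPair A B)
    (h' : SupportedPair A' B')
    (H : ∀ t : ℝ, 0 < t → ratioCalc (fun z => (resolventFun t z : ℂ)) A' B' =
      ratioCalc (fun z => (resolventFun t z : ℂ)) A B * supportProj B') :
    RatioCompatible A B A' B' := by
  refine ratioCompatible_of_spansOnFinite h h' spansOnFinite_resolvent (by simp) fun t => ?_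
  have := H t t.2
  simpa only [resolventFun, Complex.ofReal_div, Complex.ofReal_add] using this

/-- Equality for a single `p` makes the integrands of the integral representations agree for
every value of the resolvent parameter. -/
theorem ratioCompatible_of_Jp_sum {A B : Fin m → Matrix (Fin d) (Fin d) ℂ}
    (h : ∀ j, SupportedPair (A j) (B j)) {p : ℝ} (hp : p ∈ Set.Ioo (0 : ℝ) 2)
    (heq : Jp p 1 (∑ j, A j) (∑ j, B j) = ∑ j, Jp p 1 (A j) (B j)) (j : Fin m) :
    RatioCompatible (∑ k, A k) (∑ k, B k) (A j) (B j) := by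
  have hs := supportedPair_sum h
  obtain ⟨c, hc, H⟩ := exists_Jp_eq_integral (d := d) hp
  simp only [H _ _ hs, H _ _ (h _)] at heq
  rw [← Finset.mul_sum, ← integral_finsetSum _ fun j _ => integrableOn_kernel (h j) hp] at heq
  have heq' := mul_left_cancel₀ hc.ne' heq
  have hsum : ∀ t : ℝ, ∑ j, t ^ (p - 1) * ((A j).trace.re / (1 + t) -
      resolventTrace (A j) (B j) t) =
      t ^ (p - 1) * ((∑ j, A j).trace.re / (1 + t) - ∑ j, resolventTrace (A j) (B j) t) := by
    intro t
    rw [← Finset.mul_sum, Finset.sum_sub_distrib, trace_sum, Complex.re_sum, Finset.sum_div]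
  have hint := integrable_finsetSum Finset.univ fun j _ => integrableOn_kernel (h j) hp
  have hae := (integral_eq_iff_of_ae_le (integrableOn_kernel hs hp) hint
    ((ae_restrict_iff' measurableSet_Ioi).2 (Filter.Eventually.of_forall fun t ht => by
      simp only [hsum]
      have h1 := sum_resolventTrace_le h ht
      have h2 : 0 ≤ t ^ (p - 1) := Real.rpow_nonneg (le_of_lt ht) _
      gcongr))).1 heq'
  have hae2 : resolventTrace (∑ j, A j) (∑ j, B j) =ᵐ[volume.restrict (Set.Ioi 0)]
      fun t => ∑ j, resolventTrace (A j) (B j) t := by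
    filter_upwards [hae, ae_restrict_mem measurableSet_Ioi] with t h1 ht
    rw [hsum] at h1
    have h2 := mul_left_cancel₀ (Real.rpow_pos_of_pos ht (p - 1)).ne' h1
    linarith
  have hall := Measure.eqOn_open_of_ae_eq hae2 isOpen_Ioi (continuousOn_resolventTrace hs)
    (continuousOn_finsetSum _ fun j _ => continuousOn_resolventTrace (h j))
  exact ratioCompatible_of_resolvent hs (h j) fun t ht =>
    resolvent_eq_of_sum_resolventTrace_eq h ht (hall ht).symm j

theorem Jp_sum_of_ratioCompatible {A B : Fin m → Matrix (Fin d) (Fin d) ℂ}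
    (h : ∀ j, SupportedPair (A j) (B j))
    (H : ∀ j, RatioCompatible (∑ k, A k) (∑ k, B k) (A j) (B j)) {p : ℝ}
    (hp : p ∈ Set.Ioo (0 : ℝ) 2) :
    Jp p 1 (∑ j, A j) (∑ j, B j) = ∑ j, Jp p 1 (A j) (B j) := by
  rw [Jp_eq_trace (supportedPair_sum h) hp, Finset.mul_sum, trace_sum, Complex.re_sum]
  refine Finset.sum_congr rfl fun j _ => ?_
  rw [Jp_eq_trace (h j) hp, H j _ (by simp [entropyFun_zero hp]), mul_assoc,
    supportProj_mul (h j).right.1]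

end RatioCalculus

namespace RatioCalculus

open Matrix

variable {d m : ℕ} {A B : Matrix (Fin d) (Fin d) ℂ}

/-! ### Factorization through commuting matrices implies compatibility -/

theorem supportProj_eq_matInv_mul (hB : B.IsHermitian) : supportProj B = matInv B * B := by
  rw [supportProj_eq_funCalc hB, matInv, cfc_eq_funCalc, funCalc_mul_self hB]
  refine funCalc_congr fun x _ => ?_
  split_ifs with hx
  · simp [hx]
  · have : x⁻¹ * x = 1 := inv_mul_cancel₀ hx
    exact_mod_cast this.symm

theorem commute_matInv {X : Matrix (Fin d) (Fin d) ℂ} (h : Commute X B) :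
    Commute X (matInv B) :=
  (Commute.cfc_real h.symm _).symm

/-- With `S` the square root of `D⁻¹`, the product is `S X S`. -/
theorem posSemidef_mul_matInv {X D : Matrix (Fin d) (Fin d) ℂ} (hX : X.PosSemidef)
    (hD : D.PosSemidef) (h : Commute X D) : (X * matInv D).PosSemidef := by
  have hS : funCalc (fun x => ((Real.sqrt x⁻¹ : ℝ) : ℂ)) D *
      funCalc (fun x => ((Real.sqrt x⁻¹ : ℝ) : ℂ)) D = matInv D := by
    rw [funCalc_mul, matInv, cfc_eq_funCalc]
    refine funCalc_congr fun x hx => ?_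
    exact_mod_cast Real.mul_self_sqrt (inv_nonneg.2 (specSet_nonneg hD hx))
  have hS' : (funCalc (fun x => ((Real.sqrt x⁻¹ : ℝ) : ℂ)) D)ᴴ =
      funCalc (fun x => ((Real.sqrt x⁻¹ : ℝ) : ℂ)) D := by
    rw [conjTranspose_funCalc]
    simp
  have hc : Commute (funCalc (fun x => ((Real.sqrt x⁻¹ : ℝ) : ℂ)) D) X :=
    Commute.funCalc h.symm _
  have h1 := hX.conjTranspose_mul_mul_same (funCalc (fun x => ((Real.sqrt x⁻¹ : ℝ) : ℂ)) D)
  rwa [hS', hc.eq, mul_assoc, hS] at h1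

/-- If `A_j = A D⁻¹ D_j` and `B_j = B D⁻¹ D_j`, then all the pairs share the solution of the
Sylvester equation for the pair `A D⁻¹`, `B D⁻¹`, because this solution commutes with `D_j`. -/
theorem ratioCompatible_of_factorization {A B D : Fin m → Matrix (Fin d) (Fin d) ℂ}
    (h : ∀ j, SupportedPair (A j) (B j)) (hD : ∀ j, (D j).PosSemidef)
    (hDker : ∀ j, matKer (D j) = matKer (B j))
    (hAD : Commute (∑ k, A k) (∑ k, D k)) (hBD : Commute (∑ k, B k) (∑ k, D k))
    (hAj : ∀ j, A j = (∑ k, A k) * matInv (∑ k, D k) * D j)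
    (hBj : ∀ j, B j = (∑ k, B k) * matInv (∑ k, D k) * D j) (j : Fin m) :
    RatioCompatible (∑ k, A k) (∑ k, B k) (A j) (B j) := by
  have hs := supportedPair_sum h
  have hDs : (∑ k, D k).PosSemidef := posSemidef_sum _ fun k _ => hD k
  have hker : matKer (∑ k, D k) ≤ matKer (∑ k, B k) := by
    rw [matKer_le_iff]
    intro v hv
    rw [sum_mulVec]
    refine Finset.sum_eq_zero fun k _ => ?_
    have h1 := matKer_sum_le hD k
    rw [hDker k] at h1
    exact matKer_le_iff.1 h1 v hv
  have hPB := supportProj_mul_of_matKer_le hs.right.1 hDs.1 hker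
  have hApos := posSemidef_mul_matInv hs.left hDs hAD
  have hBpos := posSemidef_mul_matInv hs.right hDs hBD
  have hAinv := commute_matInv hAD
  have hBinv := commute_matInv hBD
  set As := ∑ k, A k with hAs
  set Bs := ∑ k, B k with hBs
  set Ds := ∑ k, D k with hDs'
  have hpair : SupportedPair (As * matInv Ds) (Bs * matInv Ds) := by
    refine ⟨hApos, hBpos, ?_⟩
    rw [matKer_le_iff]
    intro v hv
    have h1 : Bs *ᵥ v = 0 := by
      have h2 : Bs = Ds * (Bs * matInv Ds) := by
        rw [hBinv.eq, ← mul_assoc, (commute_matInv (Commute.refl Ds)).eq,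
          ← supportProj_eq_matInv_mul hDs.1, hPB]
      rw [h2, ← mulVec_mulVec, hv, mulVec_zero]
    have h3 : As *ᵥ v = 0 := matKer_le_iff.1 hs.ker_le v h1
    rw [hAinv.eq, ← mulVec_mulVec, h3, mulVec_zero]
  -- A Hermitian product of two Hermitian matrices has commuting factors.
  have hcomm : ∀ (k : Fin m) (X Y : Matrix (Fin d) (Fin d) ℂ), X.IsHermitian → Y.IsHermitian →
      Y = X * D k → Commute X (D k) := by
    intro k X Y hX hY hXY
    have h1 := congrArg conjTranspose hXY
    rw [conjTranspose_mul, hX.eq, hY.eq, (hD k).1.eq, hXY] at h1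
    exact h1
  refine ratioCompatible_of_resolvent hs (h j) fun t ht => ?_
  set X := ratioCalc (fun z => (resolventFun t z : ℂ)) (As * matInv Ds) (Bs * matInv Ds) with hX
  have hsyl := ratioCalc_resolvent_sylvester hpair ht
  rw [← hX] at hsyl
  have hsylj : ∀ k, A k * X + (t : ℂ) • (X * B k) = A k := by
    intro k
    have hXD : Commute X (D k) := Commute.jointCalc
      (hcomm k _ _ hpair.left.1 (h k).left.1 (hAj k))
      (hcomm k _ _ hpair.right.1 (h k).right.1 (hBj k)) _
    have h1 := congrArg (· * D k) hsyl
    simp only [add_mul, smul_mul_assoc] at h1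
    rw [mul_assoc _ X, hXD.eq, ← mul_assoc _ (D k), mul_assoc X, ← hAj k, ← hBj k] at h1
    exact h1
  have hsyls : As * X + (t : ℂ) • (X * Bs) = As := by
    rw [hAs, hBs, Finset.sum_mul, Finset.mul_sum, Finset.smul_sum, ← Finset.sum_add_distrib]
    exact Finset.sum_congr rfl fun k _ => hsylj k
  rw [ratioCalc_resolvent_eq (h j) ht (hsylj j), ratioCalc_resolvent_eq hs ht hsyls, mul_assoc,
    supportProj_mul_of_matKer_le (conjTranspose_supportProj (h j).right.1) hs.right.1]
  rw [matKer_supportProj (h j).right.1]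
  exact matKer_sum_le (fun k => (h k).right) j

/-! ### The algebra generated by functions of the ratio -/

theorem conjTranspose_funCalc_imagPow (t : ℝ) (A : Matrix (Fin d) (Fin d) ℂ) :
    (funCalc (imagPow t) A)ᴴ = funCalc (imagPow (-t)) A := by
  rw [conjTranspose_funCalc]
  congr 1
  ext x
  unfold imagPow
  split_ifs
  · simp
  · rw [Complex.star_def, ← Complex.exp_conj]
    simp

theorem funCalc_imagPow_mul (hA : A.IsHermitian) (t : ℝ) :
    funCalc (imagPow t) A * funCalc (imagPow (-t)) A = supportProj A := by
  rw [funCalc_mul, supportProj_eq_funCalc hA]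
  congr 1
  ext x
  unfold imagPow
  split_ifs
  · simp
  · rw [← Complex.exp_add]
    simp

theorem ratioCalc_imagPow (h : SupportedPair A B) (t : ℝ) :
    ratioCalc (imagPow t) A B = funCalc (imagPow t) A * funCalc (imagPow (-t)) B := by
  rw [← matPowI_mul_matPowI h, matPowI_eq_funCalc, matPowI_eq_funCalc]
  rfl

theorem supportProj_right_mul_left (h : SupportedPair A B) :
    supportProj B * supportProj A = supportProj A :=
  supportProj_mul_of_matKer_le (conjTranspose_supportProj h.left.1) h.right.1
    (by rw [matKer_supportProj h.left.1]; exact h.ker_le)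

/-- `A^{it} B^{-it}` is a partial isometry whose range is the support of `A`. -/
theorem ratioCalc_imagPow_mul_conjTranspose (h : SupportedPair A B) (t : ℝ) :
    ratioCalc (imagPow t) A B * (ratioCalc (imagPow t) A B)ᴴ = supportProj A := by
  have h1 : supportProj B * funCalc (imagPow (-t)) A = funCalc (imagPow (-t)) A := by
    rw [← supportProj_mul_funCalc h.left.1 (f := imagPow (-t)) (by simp [imagPow]), ← mul_assoc,
      supportProj_right_mul_left h]
  have h2 := funCalc_imagPow_mul h.right.1 (-t)
  rw [neg_neg] at h2
  rw [ratioCalc_imagPow h, conjTranspose_mul, conjTranspose_funCalc_imagPow,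
    conjTranspose_funCalc_imagPow, neg_neg, mul_assoc, ← mul_assoc (funCalc (imagPow (-t)) B), h2,
    h1, funCalc_imagPow_mul h.left.1]

theorem ratioCalc_imagPow_zero (h : SupportedPair A B) :
    ratioCalc (imagPow 0) A B = supportProj A := by
  rw [supportProj_eq_funCalc h.left.1, funCalc_left_eq_jointCalc h.right.1]
  refine ratioCalc_eq_jointCalc h (by simp [imagPow]) (by simp) fun x y hx hy => ?_
  by_cases h0 : x = 0
  · simp [h0, imagPow]
  · simp [h0, hy.ne', imagPow]

/-- The support of `B'` reduces the functions of the ratio of `A` and `B`: it is invariant under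
them, and the partial isometries `A^{it} B^{-it}` do not map its complement into it. -/
theorem RatioCompatible.commute_supportProj {A' B' : Matrix (Fin d) (Fin d) ℂ}
    (H : RatioCompatible A B A' B') (h : SupportedPair A B) (h' : SupportedPair A' B') {f : ℝ → ℂ}
    (hf : f 0 = 0) : Commute (supportProj B') (ratioCalc f A B) := by
  set P := supportProj B' with hP
  have hPs : Pᴴ = P := conjTranspose_supportProj h'.right.1
  have hPP : P * P = P := supportProj_mul_self h'.right.1
  have hAP : supportProj A * P = supportProj A' := by
    rw [← ratioCalc_imagPow_zero h, ← ratioCalc_imagPow_zero h', H _ (by simp [imagPow])]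
  have hPA' : P * supportProj A' = supportProj A' := supportProj_right_mul_left h'
  have hA'P : supportProj A' * P = supportProj A' := by
    have := congrArg conjTranspose hPA'
    rwa [conjTranspose_mul, hPs, conjTranspose_supportProj h'.left.1] at this
  have hu : ∀ t, P * ratioCalc (imagPow t) A B = ratioCalc (imagPow t) A B * P := by
    intro t
    have h0 : imagPow t 0 = 0 := by simp [imagPow]
    have h1 := H _ h0
    have h2 := ratioCalc_imagPow_mul_conjTranspose h t
    have h3 := ratioCalc_imagPow_mul_conjTranspose h' t
    have h4 := supportProj_left_mul_ratioCalc_right h' h0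
    rw [h1] at h3 h4
    rw [← hP] at h3 h4
    set u := ratioCalc (imagPow t) A B
    rw [conjTranspose_mul, hPs, mul_assoc, ← mul_assoc P, hPP] at h3
    -- Both `P (u uᴴ) P` and `P (u P uᴴ) P` are the support projection of `A'`.
    have h5 : (P * u * (1 - P)) * (P * u * (1 - P))ᴴ = 0 := by
      have e1 : (P * u * (1 - P)) * (P * u * (1 - P))ᴴ =
          P * (u * uᴴ) * P - P * (u * (P * uᴴ)) * P := by
        rw [conjTranspose_mul, conjTranspose_mul, conjTranspose_sub, conjTranspose_one, hPs]
        have : (1 - P) * (1 - P) = 1 - P := by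
          rw [sub_mul, one_mul, mul_sub, mul_one, hPP, sub_self, sub_zero]
        calc P * u * (1 - P) * ((1 - P) * (uᴴ * P))
            = P * u * ((1 - P) * (1 - P)) * uᴴ * P := by simp only [mul_assoc]
          _ = _ := by rw [this]; noncomm_ring
      rw [e1, h2, h3, mul_assoc P (supportProj A), hAP, hPA', hA'P, sub_self]
    rw [self_mul_conjTranspose_eq_zero, mul_sub, mul_one, sub_eq_zero, mul_assoc, h4] at h5
    exact h5
  have hF : ∀ r ∈ ratioSet A B, 0 < r := fun r hr => ratioSet_pos h hr
  have key : ∀ g : ℝ → ℂ, g 0 = 0 → ∑ r ∈ ratioSet A B,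
      g r • (P * ratioPart A B r - ratioPart A B r * P) =
      P * ratioCalc g A B - ratioCalc g A B * P := by
    intro g hg
    rw [ratioCalc_eq_sum hg (Finset.Subset.refl _) hF, Finset.mul_sum, Finset.sum_mul,
      ← Finset.sum_sub_distrib]
    simp only [mul_smul_comm, smul_mul_assoc, smul_sub]
  have hz := fun r hr => spansOnFinite_imagPow.eq_zero hF
    (C := fun r => P * ratioPart A B r - ratioPart A B r * P)
    (fun t => by rw [key _ (by simp [imagPow]), hu t, sub_self]) (r := r) hr
  rw [commute_iff_eq, ← sub_eq_zero, ← key f hf]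
  exact Finset.sum_eq_zero fun r hr => by rw [hz r hr, smul_zero]

/-- The *-algebra generated by the functions of the ratio of `A` and `B`. -/
noncomputable def ratioAlgebra (A B : Matrix (Fin d) (Fin d) ℂ) :
    StarSubalgebra ℂ (Matrix (Fin d) (Fin d) ℂ) :=
  StarAlgebra.adjoin ℂ {X | ∃ f : ℝ → ℂ, f 0 = 0 ∧ ratioCalc f A B = X}

theorem ratioCalc_mem_ratioAlgebra {f : ℝ → ℂ} (hf : f 0 = 0) :
    ratioCalc f A B ∈ ratioAlgebra A B :=
  StarAlgebra.subset_adjoin ℂ _ ⟨f, hf, rfl⟩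

theorem RatioCompatible.commute_of_mem {A' B' : Matrix (Fin d) (Fin d) ℂ}
    (H : RatioCompatible A B A' B') (h : SupportedPair A B) (h' : SupportedPair A' B')
    {x : Matrix (Fin d) (Fin d) ℂ} (hx : x ∈ ratioAlgebra A B) : Commute (supportProj B') x := by
  induction hx using StarAlgebra.adjoin_induction with
  | mem x hx =>
    obtain ⟨f, hf, rfl⟩ := hx
    exact H.commute_supportProj h h' hf
  | algebraMap r => exact (Algebra.commutes r _).symm
  | add x y _ _ hx hy => exact hx.add_right hy
  | mul x y _ _ hx hy => exact hx.mul_right hy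
  | star x _ hx =>
    have h1 := hx.star_star
    rwa [star_eq_conjTranspose, conjTranspose_supportProj h'.right.1] at h1

theorem conjTranspose_matLog (B : Matrix (Fin d) (Fin d) ℂ) : (matLog B)ᴴ = matLog B :=
  (cfc_predicate (R := ℝ) (p := IsSelfAdjoint) Real.log B).star_eq

/-- The commutator of `log B` with a function of the ratio, in terms of functions of the ratio. -/
theorem matLog_commutator (h : SupportedPair A B) {f : ℝ → ℂ} (hf : f 0 = 0) :
    matLog B * ratioCalc f A B - ratioCalc f A B * matLog B =
      ratioCalc (fun z => Real.log z * f z) A B -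
        (ratioCalc (fun z => (Real.log z : ℂ)) A B)ᴴ * ratioCalc f A B := by
  have hK : ratioCalc (fun z => (Real.log z : ℂ)) A B = matLog A - supportProj A * matLog B := by
    rw [matLog, matLog, cfc_eq_funCalc, cfc_eq_funCalc, supportProj_eq_funCalc h.left.1,
      funCalc_mul_funCalc, funCalc_left_eq_jointCalc h.right.1, jointCalc_sub]
    refine ratioCalc_eq_jointCalc h (by simp) (by simp) fun x y hx hy => ?_
    by_cases h0 : x = 0
    · simp [h0]
    · rw [Real.log_div h0 hy.ne']
      simp [h0]
  have hE : matLog A * ratioCalc f A B - ratioCalc f A B * matLog B =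
      ratioCalc (fun z => Real.log z * f z) A B := by
    rw [matLog, matLog, cfc_eq_funCalc, cfc_eq_funCalc]
    nth_rw 1 2 [ratioCalc]
    rw [funCalc_mul_jointCalc, jointCalc_mul_funCalc, jointCalc_sub]
    refine (ratioCalc_eq_jointCalc h (by simp) (by simp [hf]) fun x y hx hy => ?_).symm
    by_cases h0 : x = 0
    · simp [h0, hf]
    · rw [Real.log_div h0 hy.ne']
      push_cast
      ring
  rw [← hE, hK, conjTranspose_sub, conjTranspose_mul, conjTranspose_matLog, conjTranspose_matLog,
    conjTranspose_supportProj h.left.1, sub_mul, mul_assoc, supportProj_left_mul_ratioCalc h hf]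
  abel

/-- `log B` acts on the algebra generated by the functions of the ratio as a derivation. -/
theorem matLog_commutator_mem (h : SupportedPair A B) {x : Matrix (Fin d) (Fin d) ℂ}
    (hx : x ∈ ratioAlgebra A B) : matLog B * x - x * matLog B ∈ ratioAlgebra A B := by
  induction hx using StarAlgebra.adjoin_induction with
  | mem x hx =>
    obtain ⟨f, hf, rfl⟩ := hx
    rw [matLog_commutator h hf]
    exact sub_mem (ratioCalc_mem_ratioAlgebra (by simp))
      (mul_mem (star_mem (ratioCalc_mem_ratioAlgebra (by simp))) (ratioCalc_mem_ratioAlgebra hf))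
  | algebraMap r =>
    rw [Algebra.commutes, sub_self]
    exact zero_mem _
  | add x y _ _ hx hy =>
    convert add_mem hx hy using 1
    noncomm_ring
  | mul x y hx' hy' hx hy =>
    convert add_mem (mul_mem hx hy') (mul_mem hx' hy) using 1
    noncomm_ring
  | star x _ hx =>
    convert neg_mem (star_mem hx) using 1
    rw [star_sub, star_mul, star_mul, star_eq_conjTranspose (matLog B), conjTranspose_matLog]
    abel

/-- On the algebra generated by the functions of the ratio, `log B'` acts as `log B` does, cut
down to the support of `B'`. -/
theorem RatioCompatible.matLog_commutator_eq {A' B' : Matrix (Fin d) (Fin d) ℂ}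
    (H : RatioCompatible A B A' B') (h : SupportedPair A B) (h' : SupportedPair A' B')
    {x : Matrix (Fin d) (Fin d) ℂ} (hx : x ∈ ratioAlgebra A B) :
    matLog B' * x - x * matLog B' = (matLog B * x - x * matLog B) * supportProj B' := by
  have hLP : matLog B' * supportProj B' = matLog B' := by
    rw [matLog, cfc_eq_funCalc, supportProj_eq_funCalc h'.right.1, funCalc_mul]
    refine funCalc_congr fun x _ => ?_
    split_ifs with hx <;> simp [hx]
  have hPL : supportProj B' * matLog B' = matLog B' := by
    have := congrArg conjTranspose hLP
    rwa [conjTranspose_mul, conjTranspose_matLog, conjTranspose_supportProj h'.right.1] at this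
  induction hx using StarAlgebra.adjoin_induction with
  | mem x hx =>
    obtain ⟨f, hf, rfl⟩ := hx
    have hc := H.commute_supportProj h h' hf
    have hcK := H.commute_of_mem h h'
      (star_mem (ratioCalc_mem_ratioAlgebra (A := A) (B := B) (f := fun z => (Real.log z : ℂ))
        (by simp)))
    have h1 := matLog_commutator h' hf
    rw [H f hf, H _ (by simp), H _ (by simp), conjTranspose_mul,
      conjTranspose_supportProj h'.right.1] at h1
    rw [matLog_commutator h hf, sub_mul]
    have e1 : matLog B' * (ratioCalc f A B * supportProj B') = matLog B' * ratioCalc f A B := by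
      rw [← hc.eq, ← mul_assoc, hLP]
    have e2 : ratioCalc f A B * supportProj B' * matLog B' = ratioCalc f A B * matLog B' := by
      rw [mul_assoc, hPL]
    rw [e1, e2] at h1
    rw [h1, ← star_eq_conjTranspose, hcK.eq, mul_assoc (star _) (supportProj B'),
      ← mul_assoc (supportProj B'), hc.eq, mul_assoc _ (supportProj B'),
      supportProj_mul_self h'.right.1, mul_assoc (star _)]
  | algebraMap r => simp [Algebra.commutes]
  | add x y _ _ hx hy =>
    have := congrArg₂ (· + ·) hx hy
    rw [← add_mul] at this
    convert this using 1
    · noncomm_ring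
    · noncomm_ring
  | mul x y hx' hy' hx hy =>
    have hc := H.commute_of_mem h h' hy'
    have e1 : matLog B' * (x * y) - x * y * matLog B' =
        (matLog B' * x - x * matLog B') * y + x * (matLog B' * y - y * matLog B') := by
      noncomm_ring
    rw [e1, hx, hy, mul_assoc _ (supportProj B'), hc.eq]
    noncomm_ring
  | star x hx' hx =>
    have hc := H.commute_of_mem h h' (star_mem (matLog_commutator_mem h hx'))
    have h1 := congrArg star hx
    rw [star_mul, star_eq_conjTranspose (supportProj B'), conjTranspose_supportProj h'.right.1,
      hc.eq] at h1
    simp only [star_sub, star_mul] at h1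
    rw [star_eq_conjTranspose (matLog B'), star_eq_conjTranspose (matLog B), conjTranspose_matLog,
      conjTranspose_matLog] at h1
    rw [← neg_sub, h1, ← neg_mul, neg_sub]

/-! ### Derivations implemented by a Hermitian matrix are inner -/

/-- The trace form `Tr (x y)` is nondegenerate on a star subalgebra, so every matrix has a
projection to the subalgebra with respect to this form. -/
theorem exists_mem_trace_mul_eq (N : StarSubalgebra ℂ (Matrix (Fin d) (Fin d) ℂ))
    (L : Matrix (Fin d) (Fin d) ℂ) : ∃ h ∈ N, ∀ n ∈ N, (h * n).trace = (L * n).trace := by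
  let V : Submodule ℂ (Matrix (Fin d) (Fin d) ℂ) := Subalgebra.toSubmodule N.toSubalgebra
  let T : Matrix (Fin d) (Fin d) ℂ →ₗ[ℂ] Matrix (Fin d) (Fin d) ℂ →ₗ[ℂ] ℂ :=
    (LinearMap.mul ℂ (Matrix (Fin d) (Fin d) ℂ)).compr₂ (Matrix.traceLinearMap (Fin d) ℂ ℂ)
  let Φ : V →ₗ[ℂ] Module.Dual ℂ V := T.domRestrict₁₂ V V
  have hinj : Function.Injective Φ := by
    rw [← LinearMap.ker_eq_bot, LinearMap.ker_eq_bot']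
    intro x hx
    have h1 := LinearMap.congr_fun hx ⟨star (x : Matrix (Fin d) (Fin d) ℂ), star_mem (s := N) x.2⟩
    have h2 : ((x : Matrix (Fin d) (Fin d) ℂ) * (x : Matrix (Fin d) (Fin d) ℂ)ᴴ).trace = 0 := h1
    exact Subtype.ext (trace_mul_conjTranspose_self_eq_zero_iff.1 h2)
  have hsurj : Function.Surjective Φ :=
    (LinearMap.injective_iff_surjective_of_finrank_eq_finrank
      (Subspace.dual_finrank_eq (K := ℂ) (V := V)).symm).1 hinj
  obtain ⟨h, hh⟩ := hsurj ((T L).domRestrict V)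
  exact ⟨h, h.2, fun n hn => LinearMap.congr_fun hh ⟨n, hn⟩⟩

/-- If `L - h` is orthogonal to `N` for the trace form, then so is its commutator with `x ∈ N`; as
this commutator lies in `N`, it vanishes. Averaging `h` with its adjoint makes it Hermitian. -/
theorem exists_hermitian_implementer (N : StarSubalgebra ℂ (Matrix (Fin d) (Fin d) ℂ))
    {L : Matrix (Fin d) (Fin d) ℂ} (hL : Lᴴ = L) (hN : ∀ x ∈ N, L * x - x * L ∈ N) :
    ∃ h ∈ N, hᴴ = h ∧ ∀ x ∈ N, h * x - x * h = L * x - x * L := by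
  obtain ⟨h, hh, htr⟩ := exists_mem_trace_mul_eq N L
  have key : ∀ x ∈ N, h * x - x * h = L * x - x * L := by
    intro x hx
    have hy : h * x - x * h - (L * x - x * L) ∈ N :=
      sub_mem (sub_mem (mul_mem hh hx) (mul_mem hx hh)) (hN x hx)
    have hz : ∀ n ∈ N, ((h * x - x * h - (L * x - x * L)) * n).trace = 0 := by
      intro n hn
      have h1 := htr (x * n - n * x) (sub_mem (mul_mem hx hn) (mul_mem hn hx))
      have e : ∀ M : Matrix (Fin d) (Fin d) ℂ,
          ((M * x - x * M) * n).trace = (M * (x * n - n * x)).trace := by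
        intro M
        rw [sub_mul, mul_sub, trace_sub, trace_sub, mul_assoc, mul_assoc, trace_mul_comm x,
          mul_assoc]
      rw [sub_mul, trace_sub, e, e, h1, sub_self]
    have h2 := hz _ (star_mem hy)
    rw [star_eq_conjTranspose, trace_mul_conjTranspose_self_eq_zero_iff, sub_eq_zero] at h2
    exact h2
  have key' : ∀ x ∈ N, hᴴ * x - x * hᴴ = L * x - x * L := by
    intro x hx
    have h1 := congrArg conjTranspose (key (star x) (star_mem hx))
    simp only [star_eq_conjTranspose, conjTranspose_sub, conjTranspose_mul,
      conjTranspose_conjTranspose, hL] at h1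
    rw [← neg_sub, h1, neg_sub]
  refine ⟨(2⁻¹ : ℂ) • (h + hᴴ), N.smul_mem (add_mem hh (star_mem hh)) _, ?_, fun x hx => ?_⟩
  · rw [conjTranspose_smul, conjTranspose_add, conjTranspose_conjTranspose, add_comm]
    simp
  · have e : (2⁻¹ : ℂ) • (h + hᴴ) * x - x * (2⁻¹ : ℂ) • (h + hᴴ) =
        (2⁻¹ : ℂ) • ((h * x - x * h) + (hᴴ * x - x * hᴴ)) := by
      rw [smul_mul_assoc, mul_smul_comm, ← smul_sub]
      congr 1
      noncomm_ring
    rw [e, key x hx, key' x hx, ← two_smul ℂ, smul_smul]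
    norm_num

/-! ### Compatibility implies factorization -/

theorem mul_exp_eq_self_of_mul_eq_zero {P X : Matrix (Fin d) (Fin d) ℂ} (h : P * X = 0) :
    P * NormedSpace.exp X = P := by
  have h1 : HasSum (fun n : ℕ => P * ((n.factorial : ℂ)⁻¹ • X ^ n)) (P * NormedSpace.exp X) := by
    open scoped Matrix.Norms.Operator in
    exact (NormedSpace.exp_series_hasSum_exp' (𝕂 := ℂ) X).mul_left P
  have h2 := hasSum_single (f := fun n : ℕ => P * ((n.factorial : ℂ)⁻¹ • X ^ n)) 0 (by
    intro n hn
    obtain ⟨k, rfl⟩ := Nat.exists_eq_succ_of_ne_zero hn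
    rw [mul_smul_comm, pow_succ', ← mul_assoc, h, zero_mul, smul_zero])
  simpa using h1.unique h2

theorem supportProj_mul_exp_matLog (hB : B.PosSemidef) :
    supportProj B * NormedSpace.exp (matLog B) = B := by
  have h1 : NormedSpace.exp (matLog B) = cfc (fun x : ℝ => Real.exp (Real.log x)) B := by
    rw [matLog, hB.1.cfc_eq, hB.1.cfc_eq, IsHermitian.cfc, IsHermitian.cfc,
      Unitary.conjStarAlgAut_apply, Unitary.conjStarAlgAut_apply]
    have h2 := Matrix.exp_units_conj (Unitary.toUnits hB.1.eigenvectorUnitary)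
      (diagonal (RCLike.ofReal ∘ Real.log ∘ hB.1.eigenvalues) : Matrix (Fin d) (Fin d) ℂ)
    rw [exp_diagonal] at h2
    refine h2.trans ?_
    congr 3
    ext i
    simp [Complex.exp_eq_exp_ℂ]
  rw [h1, cfc_eq_funCalc, supportProj_eq_funCalc hB.1, funCalc_mul]
  nth_rw 2 [← funCalc_id hB.1]
  refine funCalc_congr fun x hx => ?_
  split_ifs with h0
  · simp [h0]
  · rw [Real.exp_log (lt_of_le_of_ne (specSet_nonneg hB hx) (Ne.symm h0)), one_mul]

/-- For a Hermitian `M` that commutes with the support projection `P` of `B`, the matrix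
`P exp M` is positive semidefinite and has the kernel of `B`. -/
theorem posSemidef_supportProj_mul_exp (hB : B.IsHermitian) {M : Matrix (Fin d) (Fin d) ℂ}
    (hM : Mᴴ = M) (hc : Commute (supportProj B) M) :
    (supportProj B * NormedSpace.exp M).PosSemidef ∧
      matKer (supportProj B * NormedSpace.exp M) = matKer B := by
  have hc' : Commute (supportProj B) (NormedSpace.exp M) := hc.exp_right
  constructor
  · set E := NormedSpace.exp ((2⁻¹ : ℂ) • M) with hE
    have hEs : Eᴴ = E := by
      rw [hE, ← exp_conjTranspose, conjTranspose_smul, hM]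
      simp
    have hEE : NormedSpace.exp M = E * E := by
      rw [hE, ← Matrix.exp_add_of_commute _ _ (Commute.refl _), ← add_smul]
      norm_num
    have hcE : Commute (supportProj B) E := (hc.smul_right _).exp_right
    have h1 := posSemidef_conjTranspose_mul_self (supportProj B * E)
    rw [conjTranspose_mul, hEs, conjTranspose_supportProj hB, ← mul_assoc, mul_assoc E,
      supportProj_mul_self hB, ← hcE.eq, mul_assoc, ← hEE] at h1
    exact h1
  · rw [← matKer_supportProj hB]
    apply le_antisymm
    · rw [matKer_le_iff]
      intro v hv
      have h1 : supportProj B =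
          NormedSpace.exp (-M) * (supportProj B * NormedSpace.exp M) := by
        rw [hc'.eq, ← mul_assoc, ← Matrix.exp_add_of_commute _ _ (Commute.refl M).neg_left,
          neg_add_cancel, NormedSpace.exp_zero, one_mul]
      rw [h1, ← mulVec_mulVec, hv, mulVec_zero]
    · rw [matKer_le_iff]
      intro v hv
      rw [hc'.eq, ← mulVec_mulVec, hv, mulVec_zero]

/-- The Hermitian matrix `h` in the algebra generated by the functions of the ratio that implements
the derivation given by `log B` yields a common factor: each `log B_j` is the sum of `h` on the
support of `B_j` and a matrix that commutes with the algebra. -/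
theorem exists_factorization_of_ratioCompatible {A B : Fin m → Matrix (Fin d) (Fin d) ℂ}
    (h : ∀ j, SupportedPair (A j) (B j))
    (H : ∀ j, RatioCompatible (∑ k, A k) (∑ k, B k) (A j) (B j)) :
    ∃ D : Fin m → Matrix (Fin d) (Fin d) ℂ,
      (∀ j, (D j).PosSemidef ∧ matKer (D j) = matKer (B j) ∧
        Commute (A j) (D j) ∧ Commute (B j) (D j)) ∧
      Commute (∑ k, A k) (∑ k, D k) ∧ Commute (∑ k, B k) (∑ k, D k) ∧
      ∀ j, A j = (∑ k, A k) * matInv (∑ k, D k) * D j ∧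
        B j = (∑ k, B k) * matInv (∑ k, D k) * D j := by
  have hs := supportedPair_sum h
  set N := ratioAlgebra (∑ k, A k) (∑ k, B k) with hN
  obtain ⟨g, hg, hgs, himp⟩ := exists_hermitian_implementer N
    (conjTranspose_matLog (∑ k, B k)) fun x hx => matLog_commutator_mem hs hx
  have hPN : ∀ j, ∀ x ∈ N, Commute (supportProj (B j)) x := fun j x hx =>
    (H j).commute_of_mem hs (h j) hx
  let M : Fin m → Matrix (Fin d) (Fin d) ℂ := fun j => matLog (B j) - g * supportProj (B j)
  have hMs : ∀ j, (M j)ᴴ = M j := by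
    intro j
    simp only [M]
    rw [conjTranspose_sub, conjTranspose_mul, conjTranspose_matLog,
      conjTranspose_supportProj (h j).right.1, hgs, (hPN j g hg).eq]
  have hMN : ∀ j, ∀ x ∈ N, Commute (M j) x := by
    intro j x hx
    have h1 := (H j).matLog_commutator_eq hs (h j) hx
    rw [← himp x hx] at h1
    rw [commute_iff_eq, ← sub_eq_zero]
    have e : M j * x - x * M j = (matLog (B j) * x - x * matLog (B j)) -
        (g * (supportProj (B j) * x) - x * g * supportProj (B j)) := by
      simp only [M]
      noncomm_ring
    rw [e, h1, (hPN j x hx).eq]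
    noncomm_ring
  have hPL : ∀ j, Commute (supportProj (B j)) (matLog (B j)) := by
    intro j
    rw [supportProj_eq_funCalc (h j).right.1, matLog, cfc_eq_funCalc, commute_iff_eq, funCalc_mul,
      funCalc_mul]
    simp only [mul_comm]
  have hPM : ∀ j, Commute (supportProj (B j)) (M j) := fun j =>
    (hPL j).sub_right ((hPN j g hg).mul_right (Commute.refl _))
  let D : Fin m → Matrix (Fin d) (Fin d) ℂ :=
    fun j => supportProj (B j) * NormedSpace.exp (M j)
  have hD : ∀ j, (D j).PosSemidef ∧ matKer (D j) = matKer (B j) := fun j =>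
    posSemidef_supportProj_mul_exp (h j).right.1 (hMs j) (hPM j)
  have hDN : ∀ j, ∀ x ∈ N, Commute (D j) x := fun j x hx =>
    (hPN j x hx).mul_left (hMN j x hx).exp_left
  set b := NormedSpace.exp g with hb
  have hBb : ∀ j, B j = b * D j := by
    intro j
    have hgP := hPN j g hg
    have hPP := supportProj_mul_self (h j).right.1
    have e1 : matLog (B j) = g * supportProj (B j) + M j := by simp [M]
    have hcomm : Commute (g * supportProj (B j)) (M j) :=
      (hMN j g hg).symm.mul_left (hPM j)
    -- On the support of `B j`, only the part of `g` on that support contributes to `exp g`.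
    have e2 : b = NormedSpace.exp (g * (1 - supportProj (B j))) *
        NormedSpace.exp (g * supportProj (B j)) := by
      rw [← Matrix.exp_add_of_commute, ← mul_add, sub_add_cancel, mul_one, hb]
      have h1 : Commute (1 - supportProj (B j)) (supportProj (B j)) :=
        (Commute.one_left _).sub_left (Commute.refl _)
      have h2 : Commute (1 - supportProj (B j)) g := (Commute.one_left _).sub_left hgP
      exact ((Commute.refl g).mul_left h2).mul_right (hgP.symm.mul_left h1)
    have e3 : supportProj (B j) * b =
        supportProj (B j) * NormedSpace.exp (g * supportProj (B j)) := by
      have h0 : supportProj (B j) * (g * (1 - supportProj (B j))) = 0 := by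
        rw [← mul_assoc, hgP.eq, mul_assoc, mul_sub, mul_one, hPP, sub_self, mul_zero]
      rw [e2, ← mul_assoc, mul_exp_eq_self_of_mul_eq_zero h0]
    have hbP : Commute (supportProj (B j)) b := hgP.exp_right
    calc B j = supportProj (B j) * NormedSpace.exp (matLog (B j)) :=
          (supportProj_mul_exp_matLog (h j).right).symm
      _ = supportProj (B j) * b * NormedSpace.exp (M j) := by
          rw [e1, Matrix.exp_add_of_commute _ _ hcomm, ← mul_assoc, e3]
      _ = b * D j := by rw [hbP.eq, mul_assoc]
  have hDb : ∀ j, Commute (D j) b := fun j => (hDN j g hg).exp_right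
  set u := ratioCalc (fun z => (z : ℂ)) (∑ k, A k) (∑ k, B k) with hu
  have huN : u ∈ N := ratioCalc_mem_ratioAlgebra (by simp)
  have hAu : ∀ j, A j = u * b * D j := by
    intro j
    have h1 : A j = ratioCalc (fun z => (z : ℂ)) (A j) (B j) * B j := by
      rw [ratioCalc_mul_right (h j).right.1]
      nth_rw 1 [left_eq_jointCalc (h j).left.1 (h j).right.1]
      refine jointCalc_congr (h j).left (h j).right (h j).ker_le (by simp) fun x y _ hy => ?_
      have : x = x / y * y := (div_mul_cancel₀ x hy.ne').symm
      exact_mod_cast this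
    rw [h1, H j _ (by simp), mul_assoc, supportProj_mul (h j).right.1, mul_assoc, ← hBb j]
  have hDub : ∀ j, Commute (D j) (u * b) := fun j => (hDN j u huN).mul_right (hDb j)
  have hBsum : ∑ k, B k = b * ∑ k, D k := by
    rw [Finset.mul_sum]
    exact Finset.sum_congr rfl fun k _ => hBb k
  have hAsum : ∑ k, A k = u * b * ∑ k, D k := by
    rw [Finset.mul_sum]
    exact Finset.sum_congr rfl fun k _ => hAu k
  have hDs : (∑ k, D k).PosSemidef := posSemidef_sum _ fun k _ => (hD k).1
  have hDinv : ∀ j, (∑ k, D k) * matInv (∑ k, D k) * D j = D j := by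
    intro j
    rw [(commute_matInv (Commute.refl (∑ k, D k))).eq, ← supportProj_eq_matInv_mul hDs.1]
    exact supportProj_mul_of_matKer_le (hD j).1.1 hDs.1 (matKer_sum_le (fun k => (hD k).1) j)
  have hcomm : ∀ X : Matrix (Fin d) (Fin d) ℂ, (∀ j, Commute (D j) X) →
      Commute (X * ∑ k, D k) (∑ k, D k) := fun X hX =>
    (Commute.sum_right _ _ _ fun j _ => (hX j).symm).mul_left (Commute.refl _)
  refine ⟨D, fun j => ⟨(hD j).1, (hD j).2, ?_, ?_⟩, ?_, ?_, fun j => ⟨?_, ?_⟩⟩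
  · rw [hAu j]
    exact (hDub j).symm.mul_left (Commute.refl _)
  · nth_rw 1 [hBb j]
    exact (hDb j).symm.mul_left (Commute.refl _)
  · rw [hAsum]
    exact hcomm _ hDub
  · rw [hBsum]
    exact hcomm _ hDb
  · rw [hAsum, mul_assoc, mul_assoc, ← mul_assoc (∑ k, D k), hDinv j]
    exact hAu j
  · rw [hBsum, mul_assoc, mul_assoc, ← mul_assoc (∑ k, D k), hDinv j]
    exact hBb j

end RatioCalculus

open RatioCalculus in
theorem mainTheorem4 {d m : ℕ} (A B : Fin m → Matrix (Fin d) (Fin d) ℂ)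
    (hA : ∀ j, (A j).PosSemidef) (hB : ∀ j, (B j).PosSemidef)
    (hker : ∀ j, matKer (B j) ≤ matKer (A j)) :
    List.TFAE [
      ∀ p ∈ Set.Ioo (0 : ℝ) 2,
        Jp p 1 (∑ j, A j) (∑ j, B j) = ∑ j, Jp p 1 (A j) (B j),
      ∃ p ∈ Set.Ioo (0 : ℝ) 2,
        Jp p 1 (∑ j, A j) (∑ j, B j) = ∑ j, Jp p 1 (A j) (B j),
      ∀ (j : Fin m) (t : ℝ),
        matPowI (A j) t * matPowI (B j) (-t) =
          matPowI (∑ k, A k) t * matPowI (∑ k, B k) (-t) * supportProj (B j),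
      ∃ D : Fin m → Matrix (Fin d) (Fin d) ℂ,
        (∀ j, (D j).PosSemidef ∧ matKer (D j) = matKer (B j) ∧
          Commute (A j) (D j) ∧ Commute (B j) (D j)) ∧
        Commute (∑ k, A k) (∑ k, D k) ∧ Commute (∑ k, B k) (∑ k, D k) ∧
        ∀ j, A j = (∑ k, A k) * matInv (∑ k, D k) * D j ∧
          B j = (∑ k, B k) * matInv (∑ k, D k) * D j] := by
  have h : ∀ j, SupportedPair (A j) (B j) := fun j => ⟨hA j, hB j, hker j⟩
  have hs := supportedPair_sum h
  tfae_have 1 → 2 := fun H => ⟨1, ⟨one_pos, one_lt_two⟩, H 1 ⟨one_pos, one_lt_two⟩⟩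
  tfae_have 2 → 3 := fun ⟨p, hp, heq⟩ j =>
    (ratioCompatible_iff_matPowI hs (h j)).1 (ratioCompatible_of_Jp_sum h hp heq j)
  tfae_have 3 → 4 := fun H => exists_factorization_of_ratioCompatible h fun j =>
    (ratioCompatible_iff_matPowI hs (h j)).2 (H j)
  tfae_have 4 → 1 := fun ⟨D, hD, hAD, hBD, hfac⟩ p hp =>
    Jp_sum_of_ratioCompatible h (ratioCompatible_of_factorization h (fun j => (hD j).1)
      (fun j => (hD j).2.1) hAD hBD (fun j => (hfac j).1) (fun j => (hfac j).2)) hp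
  tfae_finish
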